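/- Let $\Bbbk$ be a field of characteristic zero, let $S\subseteq\mathbb N$ be a numerical semigroup (a submonoid of $(\mathbb N,+)$ with finite complement), and let $0\neq n\in S$, for instance the multiplicity of $S$. Let $\mathrm{Ap}(S,n)=\{s\in S : s-n\notin S\}$ be the Apéry set, let $Q=\Bbbk[S]/(t^n)=\Bbbk[S]/(t^s : s\in S\setminus \mathrm{Ap}(S,n))$, a local Artinian algebra with $\Bbbk$-basis $\{t^\omega : \omega\in\mathrm{Ap}(S,n)\}$ and maximal ideal $\mathfrak m=(t^s : 0\ne s\in S)$, and let \[A=\operatorname{gr}_{\mathfrak m}(Q)=\bigoplus_{i\ge 0}\mathfrak m^i/\mathfrak m^{i+1}\] be the graded algebra arising from the Apéry set. Suppose that $A$ has codimension three, that is, $\dim_\Bbbk A_1=3$, and that $A$ is Gorenstein, that is, its socle is one-dimensional over $\Bbbk$. Then: 1. $A$ has the strong Lefschetz property: there is a linear form $\ell\in A_1$ such that for all $i,d\ge 0$ the multiplication map $\ell^d\colon A_i\to A_{i+d}$ has maximal rank (is injective or surjective). 2. There are integers $0\le\alpha_j\le d_j$ $(j=1,2,3)$ with $d_1=\alpha_2+\alpha_3$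 such that $A$ is isomorphic, as a graded $\Bbbk$-algebra, to $\Bbbk[x_1,x_2,x_3]/K'$, where \[K'=(x_1^{d_1}-x_2^{\alpha_2}x_3^{\alpha_3},\ x_2^{d_2},\ x_3^{d_3})+x_1^{d_1-\alpha_1}(x_2^{d_2-\alpha_2},\ x_3^{d_3-\alpha_3}).\] -/

import Mathlib

noncomputable section

/-- A numerical semigroup: a submonoid of `(ℕ, +)` with finite complement. -/
def IsNumericalSemigroup (S : AddSubmonoid ℕ) : Prop :=
  ((S : Set ℕ)ᶜ).Finite

/-- The Apéry set `Ap(S, n) = {s ∈ S : s - n ∉ S}`. -/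
def aperySet (S : AddSubmonoid ℕ) (n : ℕ) : Set ℕ :=
  {s | s ∈ S ∧ ¬ ∃ u ∈ S, s = u + n}

/-- The monomial `t ^ s` of the semigroup ring `K[S]`. -/
def semigroupMonomial (K : Type*) [Field K] (S : AddSubmonoid ℕ) (s : S) :
    AddMonoidAlgebra K S :=
  AddMonoidAlgebra.single s 1

/-- The ideal of `K[S]` generated by the monomials `t ^ s` with `s ∈ S` outside `Ap(S, n)`. For
`n ∈ S` it is the principal ideal `(t ^ n)`, see `aperyIdeal_eq_span`. -/
def aperyIdeal (K : Type*) [Field K] (S : AddSubmonoid ℕ) (n : ℕ) :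
    Ideal (AddMonoidAlgebra K S) :=
  Ideal.span (semigroupMonomial K S '' {s : S | (s : ℕ) ∉ aperySet S n})

theorem aperyIdeal_eq_span (K : Type*) [Field K] (S : AddSubmonoid ℕ) (n : S) :
    aperyIdeal K S n = Ideal.span {semigroupMonomial K S n} := by
  apply le_antisymm
  · refine Ideal.span_le.2 ?_
    rintro _ ⟨s, hs, rfl⟩
    have hs' : ∃ u ∈ S, (s : ℕ) = u + n := by
      by_contra h
      exact hs ⟨s.2, h⟩
    obtain ⟨u, hu, h⟩ := hs'
    have e : s = ⟨u, hu⟩ + n := Subtype.ext h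
    refine Ideal.mem_span_singleton'.2 ⟨semigroupMonomial K S ⟨u, hu⟩, ?_⟩
    rw [e]
    simp [semigroupMonomial, AddMonoidAlgebra.single_mul_single]
  · refine Ideal.span_mono ?_
    rintro _ rfl
    exact ⟨n, fun h => h.2 ⟨0, S.zero_mem, by simp⟩, rfl⟩

/-- The local Artinian algebra `K[S] / (t ^ n)`, with `K`-basis the residue classes of the `t ^ ω`,
`ω ∈ Ap(S, n)`. -/
abbrev AperyRing (K : Type*) [Field K] (S : AddSubmonoid ℕ) (n : ℕ) : Type _ :=
  AddMonoidAlgebra K S ⧸ aperyIdeal K S n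

/-- The maximal ideal of `K[S] / (t ^ n)`, generated by the classes of `t ^ s`, `0 ≠ s ∈ S`. -/
def aperyMaximalIdeal (K : Type*) [Field K] (S : AddSubmonoid ℕ) (n : ℕ) :
    Ideal (AperyRing K S n) :=
  (Ideal.span (semigroupMonomial K S '' {s : S | s ≠ 0})).map
    (Ideal.Quotient.mk (aperyIdeal K S n))

/-- The associated graded ring `⨁ᵢ Iⁱ / Iⁱ⁺¹`, as the quotient of the Rees algebra
`⨁ᵢ Iⁱ Xⁱ` by its ideal generated by `I`, i.e. by `⨁ᵢ Iⁱ⁺¹ Xⁱ`. -/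
def AssociatedGradedRing {Q : Type*} [CommRing Q] (I : Ideal Q) : Type _ :=
  reesAlgebra I ⧸ I.map (algebraMap Q (reesAlgebra I))

instance {Q : Type*} [CommRing Q] (I : Ideal Q) : CommRing (AssociatedGradedRing I) :=
  inferInstanceAs (CommRing (reesAlgebra I ⧸ I.map (algebraMap Q (reesAlgebra I))))

instance (K : Type*) [Field K] {Q : Type*} [CommRing Q] [Algebra K Q] (I : Ideal Q) :
    Algebra K (AssociatedGradedRing I) :=
  inferInstanceAs (Algebra K (reesAlgebra I ⧸ I.map (algebraMap Q (reesAlgebra I))))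

/-- The quotient map from the Rees algebra to the associated graded ring. -/
def associatedGradedMk (K : Type*) [Field K] {Q : Type*} [CommRing Q] [Algebra K Q]
    (I : Ideal Q) : reesAlgebra I →ₐ[K] AssociatedGradedRing I :=
  Ideal.Quotient.mkₐ K (I.map (algebraMap Q (reesAlgebra I)))

/-- The component `Iⁱ / Iⁱ⁺¹` of the associated graded ring: the classes of the elements `r Xⁱ`,
`r ∈ Iⁱ`, of the Rees algebra. -/
def associatedGradedPiece (K : Type*) [Field K] {Q : Type*} [CommRing Q] [Algebra K Q]
    (I : Ideal Q) (i : ℕ) : Submodule K (AssociatedGradedRing I) :=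
  (Submodule.comap ((reesAlgebra I).val.restrictScalars K).toLinearMap
    ((LinearMap.range (Polynomial.monomial (R := Q) i)).restrictScalars K)).map
    (associatedGradedMk K I).toLinearMap

/-- The graded algebra arising from the Apéry set `Ap(S, n)`: the associated graded ring of
`K[S] / (t ^ n)` with respect to its maximal ideal. -/
abbrev AperyAlgebra (K : Type*) [Field K] (S : AddSubmonoid ℕ) (n : ℕ) : Type _ :=
  AssociatedGradedRing (aperyMaximalIdeal K S n)

/-- The homogeneous components of `AperyAlgebra K S n`. -/
def aperyGrading (K : Type*) [Field K] (S : AddSubmonoid ℕ) (n : ℕ) (i : ℕ) :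
    Submodule K (AperyAlgebra K S n) :=
  associatedGradedPiece K (aperyMaximalIdeal K S n) i

section Graded

variable {K : Type*} [Field K] {A : Type*} [CommRing A] [Algebra K A]

/-- The socle of a graded algebra: the annihilator of all elements of positive degree. -/
def gradedSocle (𝒜 : ℕ → Submodule K A) : Submodule K A where
  carrier := {a | ∀ i, 0 < i → ∀ x ∈ 𝒜 i, x * a = 0}
  add_mem' := by
    intro a b ha hb i hi x hx
    rw [mul_add, ha i hi x hx, hb i hi x hx, add_zero]
  zero_mem' := by
    intro i _ x _
    exact mul_zero x
  smul_mem' := by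
    intro c a ha i hi x hx
    rw [mul_smul_comm, ha i hi x hx, smul_zero]

/-- A standard graded Artinian algebra (with `K` in degree zero) is Gorenstein if its socle is
one-dimensional. -/
def IsGradedGorenstein (𝒜 : ℕ → Submodule K A) : Prop :=
  Module.finrank K (gradedSocle 𝒜) = 1

/-- The strong Lefschetz property: for some linear form `ℓ`, each multiplication map
`ℓ ^ d : 𝒜 i → 𝒜 (i + d)` has maximal rank, that is, is injective or surjective. -/
def HasSLP (𝒜 : ℕ → Submodule K A) : Prop :=
  ∃ ℓ ∈ 𝒜 1, ∀ i d : ℕ,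
    Set.InjOn (fun a => ℓ ^ d * a) (𝒜 i : Set A) ∨
      Set.SurjOn (fun a => ℓ ^ d * a) (𝒜 i : Set A) (𝒜 (i + d) : Set A)

end Graded

/-- The ideal
`(x₀^d₀ + c x₁^α₁ x₂^α₂, x₁^d₁, x₂^d₂) + x₀^(d₀-α₀) (x₁^(d₁-α₁), x₂^(d₂-α₂))`
of `K[x₀, x₁, x₂]`; it is used for `α ≤ d` only. -/
def binomialIdeal (K : Type*) [Field K] (c : K) (d α : Fin 3 → ℕ) :
    Ideal (MvPolynomial (Fin 3) K) :=
  Ideal.span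
    {MvPolynomial.X 0 ^ d 0 +
        MvPolynomial.C c * (MvPolynomial.X 1 ^ α 1 * MvPolynomial.X 2 ^ α 2),
      MvPolynomial.X 1 ^ d 1, MvPolynomial.X 2 ^ d 2,
      MvPolynomial.X 0 ^ (d 0 - α 0) * MvPolynomial.X 1 ^ (d 1 - α 1),
      MvPolynomial.X 0 ^ (d 0 - α 0) * MvPolynomial.X 2 ^ (d 2 - α 2)}

/-- The degree `i` component of `K[x₀, x₁, x₂] / J` for a homogeneous ideal `J`. -/
def quotientGrading {K : Type*} [Field K] (J : Ideal (MvPolynomial (Fin 3) K)) (i : ℕ) :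
    Submodule K (MvPolynomial (Fin 3) K ⧸ J) :=
  (MvPolynomial.homogeneousSubmodule (Fin 3) K i).map (Ideal.Quotient.mkₐ K J).toLinearMap

end

noncomputable section

/-- Lefschetz injectivity for `sl₂`-representations, relative to a stable subspace. -/
theorem mem_of_raising_pow_mem {K V : Type*} [Field K] [CharZero K] [AddCommGroup V] [Module K V]
    {E F H : Module.End K V} (hEF : E * F = F * E + H) (hHE : H * E = E * H + 2 * E)
    (hHF : H * F = F * H - 2 * F) (J : Submodule K V) (hE : ∀ v ∈ J, E v ∈ J)
    (hF : ∀ v ∈ J, F v ∈ J) (hnil : ∀ v, ∃ N : ℕ, (F ^ N) v ∈ J) (s : ℕ) :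
    ∀ (w : ℤ) (v : V), H v = (w : K) • v → (s : ℤ) ≤ -w → (E ^ s) v ∈ J → v ∈ J := by
  have eEF (v : V) : E (F v) = F (E v) + H v := by simpa using LinearMap.congr_fun hEF v
  have eHE (v : V) : H (E v) = E (H v) + (2 : K) • E v := by
    have := LinearMap.congr_fun hHE v
    simpa [two_mul, two_smul] using this
  have eHF (v : V) : H (F v) = F (H v) - (2 : K) • F v := by
    have := LinearMap.congr_fun hHF v
    simpa [two_mul, two_smul] using this
  let C : Module.End K V := (4 : K) • (F * E) + H * H + (2 : K) • H
  have eC (v : V) : C v = (4 : K) • F (E v) + H (H v) + (2 : K) • H v := by simp [C]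
  have eCE (v : V) : C (E v) = E (C v) := by
    simp only [eC, eHE, map_add, map_smul, eEF]
    module
  have eCF (v : V) : C (F v) = F (C v) := by
    simp only [eC, eHF, map_add, map_smul, eEF, map_sub]
    module
  have eCH (v : V) : C (H v) = H (C v) := by
    simp only [eC, eHE, eHF, map_add, map_smul]
    module
  have eCEp (s : ℕ) (v : V) : C ((E ^ s) v) = (E ^ s) (C v) := by
    induction s with
    | zero => simp
    | succ s ih => rw [pow_succ', Module.End.mul_apply, Module.End.mul_apply, eCE, ih]
  have eCFp (s : ℕ) (v : V) : C ((F ^ s) v) = (F ^ s) (C v) := by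
    induction s with
    | zero => simp
    | succ s ih => rw [pow_succ', Module.End.mul_apply, Module.End.mul_apply, eCF, ih]
  have wE (s : ℕ) (w : ℤ) (v : V) (hv : H v = (w : K) • v) :
      H ((E ^ s) v) = ((w + 2 * s : ℤ) : K) • (E ^ s) v := by
    induction s with
    | zero => simpa using hv
    | succ s ih =>
      rw [pow_succ', Module.End.mul_apply, eHE, ih, map_smul]
      push_cast
      module
  have wF (s : ℕ) (w : ℤ) (v : V) (hv : H v = (w : K) • v) :
      H ((F ^ s) v) = ((w - 2 * s : ℤ) : K) • (F ^ s) v := by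
    induction s with
    | zero => simpa using hv
    | succ s ih =>
      rw [pow_succ', Module.End.mul_apply, eHF, ih, map_smul]
      push_cast
      module
  have hFp (s : ℕ) (v : V) (hv : v ∈ J) : (F ^ s) v ∈ J := by
    induction s with
    | zero => simpa
    | succ s ih => rw [pow_succ', Module.End.mul_apply]; exact hF _ ih
  induction s with
  | zero => intro w v _ _ h; simpa using h
  | succ s ih =>
    intro w v hv hs hEv
    obtain ⟨μ, hμ⟩ : ∃ μ : ℤ, μ = w + 2 * s := ⟨_, rfl⟩
    obtain ⟨u, hu⟩ : ∃ u : V, u = C v - ((μ * (μ + 2) : ℤ) : K) • v := ⟨_, rfl⟩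
    have huJ : u ∈ J := by
      refine ih w u ?_ (by push_cast at hs; omega) ?_
      · rw [hu, map_sub, ← eCH, map_smul, hv, map_smul]
        module
      · have h1 : (E ^ s) u = (4 : K) • F ((E ^ (s + 1)) v) := by
          rw [hu, map_sub, ← eCEp, map_smul, eC, wE s w v hv, map_smul, wE s w v hv, ← hμ,
            pow_succ', Module.End.mul_apply]
          push_cast
          module
        rw [h1]
        exact J.smul_mem _ (hF _ hEv)
    have descend (n : ℕ) (h : (F ^ (n + 1)) v ∈ J) : (F ^ n) v ∈ J := by
      obtain ⟨w', hw'⟩ : ∃ w' : ℤ, w' = w - 2 * n := ⟨_, rfl⟩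
      have h1 : ((((μ + w') * (μ - w' + 2) : ℤ) : K)) • (F ^ n) v =
          (4 : K) • E ((F ^ (n + 1)) v) - (F ^ n) u := by
        have h2 : (F ^ n) u = C ((F ^ n) v) - ((μ * (μ + 2) : ℤ) : K) • (F ^ n) v := by
          rw [hu, map_sub, map_smul, eCFp]
        rw [h2, eC, pow_succ', Module.End.mul_apply, eEF, wF n w v hv, map_smul, wF n w v hv,
          ← hw']
        push_cast
        module
      have hne : ((((μ + w') * (μ - w' + 2) : ℤ) : K)) ≠ 0 := by
        refine Int.cast_ne_zero.2 (mul_ne_zero ?_ ?_) <;> push_cast at hs <;> omega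
      refine (J.smul_mem_iff hne).1 ?_
      rw [h1]
      exact J.sub_mem (J.smul_mem _ (hE _ h)) (hFp _ _ huJ)
    obtain ⟨N, hN⟩ := hnil v
    have : ∀ N, (F ^ N) v ∈ J → v ∈ J := by
      intro N
      induction N with
      | zero => intro h; simpa using h
      | succ N ihN => exact fun h => ihN (descend N h)
    exact this N hN

end

noncomputable section

open MvPolynomial

section

variable {K σ : Type*} [Field K]

/-- The component in the variable `i` of the lowering operator of the `sl₂`-action on polynomials
which descends to the quotient by `(Xᵢ ^ nᵢ)`. -/
def lowering (n : σ → ℕ) (i : σ) : Module.End K (MvPolynomial σ K) :=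
  ((n i : K) - 1) • (pderiv i).toLinearMap -
    LinearMap.mulLeft K (X i) * (pderiv i).toLinearMap * (pderiv i).toLinearMap

/-- The component in the variable `i` of the weight operator. -/
def weighing (n : σ → ℕ) (i : σ) : Module.End K (MvPolynomial σ K) :=
  (2 : K) • (LinearMap.mulLeft K (X i) * (pderiv i).toLinearMap) - ((n i : K) - 1) • 1

theorem lowering_apply (n : σ → ℕ) (i : σ) (p : MvPolynomial σ K) :
    lowering n i p = C ((n i : K) - 1) * pderiv i p - X i * pderiv i (pderiv i p) := by
  simp [lowering, smul_eq_C_mul]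

theorem weighing_apply (n : σ → ℕ) (i : σ) (p : MvPolynomial σ K) :
    weighing n i p = 2 * (X i * pderiv i p) - C ((n i : K) - 1) * p := by
  simp [weighing, smul_eq_C_mul, map_ofNat C 2]

theorem pderiv_pderiv_comm (i j : σ) (p : MvPolynomial σ K) :
    pderiv i (pderiv j p) = pderiv j (pderiv i p) := by
  have : ⁅(pderiv i : Derivation K (MvPolynomial σ K) (MvPolynomial σ K)),
      (pderiv j : Derivation K (MvPolynomial σ K) (MvPolynomial σ K))⁆ = 0 := by
    classical
    apply derivation_ext
    intro k
    simp only [Derivation.commutator_apply, pderiv_X, Pi.single_apply]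
    split_ifs <;> simp
  have h := DFunLike.congr_fun this p
  rw [Derivation.commutator_apply] at h
  exact sub_eq_zero.1 h

theorem pderiv_two (i : σ) : pderiv i (2 : MvPolynomial σ K) = 0 := by
  rw [← map_ofNat C 2, pderiv_C]

theorem mulLeft_mul_lowering [DecidableEq σ] (n : σ → ℕ) (i j : σ) :
    LinearMap.mulLeft K (X i) * lowering n j =
      lowering n j * LinearMap.mulLeft K (X i) + if i = j then weighing n i else 0 := by
  refine LinearMap.ext fun p => ?_
  by_cases h : i = j
  · subst h
    simp [lowering_apply, weighing_apply]
    ring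
  · simp [lowering_apply, h]
    ring

theorem weighing_mul_mulLeft [DecidableEq σ] (n : σ → ℕ) (i j : σ) :
    weighing n i * LinearMap.mulLeft K (X j) =
      LinearMap.mulLeft K (X j) * weighing n i +
        if i = j then 2 * LinearMap.mulLeft K (X i) else 0 := by
  refine LinearMap.ext fun p => ?_
  by_cases h : i = j
  · subst h
    simp [weighing_apply, two_mul]
    ring
  · simp [weighing_apply, h]
    ring

theorem weighing_mul_lowering [DecidableEq σ] (n : σ → ℕ) (i j : σ) :
    weighing (K := K) n i * lowering n j =
      lowering n j * weighing n i - if i = j then 2 * lowering n i else 0 := by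
  refine LinearMap.ext fun p => ?_
  by_cases h : i = j
  · subst h
    simp [weighing_apply, lowering_apply, two_mul]
    ring
  · simp [weighing_apply, lowering_apply, h, Ne.symm h, Derivation.leibniz,
      pderiv_two, pderiv_pderiv_comm j i]
    ring

/-- The ideal generated by the pure powers `Xᵢ ^ nᵢ`. -/
def purePowerIdeal (K : Type*) [Field K] (n : σ → ℕ) : Ideal (MvPolynomial σ K) :=
  Ideal.span (Set.range fun i => X i ^ n i)

theorem lowering_mem_purePowerIdeal (n : σ → ℕ) (i : σ) (p : MvPolynomial σ K)
    (hp : p ∈ purePowerIdeal K n) : lowering n i p ∈ purePowerIdeal K n := by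
  refine Submodule.span_induction (p := fun p _ => ∀ q, lowering n i (q * p) ∈ purePowerIdeal K n)
    ?_ ?_ ?_ ?_ hp 1 |> fun h => by simpa using h
  · rintro _ ⟨j, rfl⟩ q
    have hj : X j ^ n j ∈ purePowerIdeal K n := Ideal.subset_span ⟨j, rfl⟩
    by_cases h : i = j
    · subst h
      obtain hn | ⟨k, hk⟩ : n i = 0 ∨ ∃ k, n i = k + 1 := by
        cases n i with
        | zero => exact Or.inl rfl
        | succ k => exact Or.inr ⟨k, rfl⟩
      · rw [hn, pow_zero] at hj
        rw [Ideal.eq_top_of_isUnit_mem _ hj isUnit_one]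
        trivial
      · have : lowering n i (q * X i ^ n i) =
            (lowering n i q - C (2 * (n i : K)) * pderiv i q) * X i ^ n i := by
          obtain rfl | ⟨l, rfl⟩ : k = 0 ∨ ∃ l, k = l + 1 := by
            cases k with
            | zero => exact Or.inl rfl
            | succ k => exact Or.inr ⟨k, rfl⟩
          · simp [lowering_apply, hk, map_ofNat C 2]
            ring
          · simp [lowering_apply, hk, Derivation.leibniz_pow, map_ofNat C 2]
            ring
        rw [this]
        exact Ideal.mul_mem_left _ _ hj
    · have h0 : pderiv i (X j ^ n j : MvPolynomial σ K) = 0 := by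
        rw [Derivation.leibniz_pow, pderiv_X_of_ne (Ne.symm h)]; simp
      have : lowering n i (q * X j ^ n j) = lowering n i q * X j ^ n j := by
        simp [lowering_apply, Derivation.leibniz, h0]
        ring
      rw [this]
      exact Ideal.mul_mem_left _ _ hj
  · simp
  · intro x y _ _ hx hy q
    rw [mul_add, map_add]
    exact Ideal.add_mem _ (hx q) (hy q)
  · intro a x _ hx q
    rw [smul_eq_mul, ← mul_assoc]
    exact hx _

variable [Fintype σ]

theorem sum_weighing_apply (n : σ → ℕ) {k : ℕ} {p : MvPolynomial σ K} (hp : p.IsHomogeneous k) :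
    (∑ i, weighing n i) p =
      (((2 * k + Fintype.card σ : ℤ) - ∑ i, (n i : ℤ) : ℤ) : K) • p := by
  have h := hp.sum_X_mul_pderiv
  simp only [LinearMap.sum_apply, weighing_apply, Finset.sum_sub_distrib, ← Finset.mul_sum, h,
    ← Finset.sum_mul, smul_eq_C_mul]
  simp [map_ofNat C 2]
  ring

theorem exists_sum_lowering_pow_eq_zero (n : σ → ℕ) (p : MvPolynomial σ K) :
    ∃ N : ℕ, ((∑ i, lowering n i) ^ N) p = 0 := by
  have hom (q : MvPolynomial σ K) (k : ℕ) (hq : q.IsHomogeneous (k + 1)) :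
      ((∑ i, lowering n i) q).IsHomogeneous k := by
    rw [LinearMap.sum_apply]
    refine IsHomogeneous.sum _ _ _ fun i _ => ?_
    rw [lowering_apply]
    have h1 : (pderiv i q).IsHomogeneous k := hq.pderiv
    refine (homogeneousSubmodule σ K k).sub_mem (h1.C_mul _) ?_
    rw [mem_homogeneousSubmodule]
    obtain rfl | ⟨l, rfl⟩ : k = 0 ∨ ∃ l, k = l + 1 := by
      cases k with
      | zero => exact Or.inl rfl
      | succ k => exact Or.inr ⟨k, rfl⟩
    · have : pderiv i (pderiv i q) = 0 := by
        rw [totalDegree_eq_zero_iff_eq_C.1 ((totalDegree_zero_iff_isHomogeneous σ).2 h1), pderiv_C]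
      rw [this, mul_zero]
      exact isHomogeneous_zero _ _ _
    · have h2 : (pderiv i (pderiv i q)).IsHomogeneous l := h1.pderiv
      simpa [add_comm] using (isHomogeneous_X K i).mul h2
  have key (k : ℕ) : ∀ q : MvPolynomial σ K, q.IsHomogeneous k →
      ((∑ i, lowering n i) ^ (k + 1)) q = 0 := by
    induction k with
    | zero =>
      intro q hq
      rw [totalDegree_eq_zero_iff_eq_C.1 ((totalDegree_zero_iff_isHomogeneous σ).2 hq)]
      simp [lowering_apply]
    | succ k ih =>
      intro q hq
      rw [pow_succ, Module.End.mul_apply]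
      exact ih _ (hom q k hq)
  refine ⟨p.totalDegree + 1, ?_⟩
  suffices h : ((∑ i, lowering n i) ^ (p.totalDegree + 1))
      (∑ i ∈ Finset.range (p.totalDegree + 1), homogeneousComponent i p) = 0 by
    rwa [sum_homogeneousComponent] at h
  rw [map_sum]
  refine Finset.sum_eq_zero fun i hi => ?_
  obtain ⟨r, hr⟩ := Nat.exists_eq_add_of_lt (Finset.mem_range.1 hi)
  have : p.totalDegree + 1 = r + (i + 1) := by omega
  rw [this, pow_add, Module.End.mul_apply, key i _ (homogeneousComponent_isHomogeneous _ _), map_zero]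

/-- The strong Lefschetz property of monomial complete intersections: powers of the sum of the
variables are injective modulo `(Xᵢ ^ nᵢ)` up to the reflected degree. -/
theorem mem_purePowerIdeal_of_sum_X_pow_mul [CharZero K] (n : σ → ℕ) {k s : ℕ}
    (hks : s + 2 * k + Fintype.card σ ≤ ∑ i, n i) {p : MvPolynomial σ K} (hp : p.IsHomogeneous k)
    (h : (∑ i, X i) ^ s * p ∈ purePowerIdeal K n) : p ∈ purePowerIdeal K n := by
  classical
  have hE : ∑ i, LinearMap.mulLeft K (X i : MvPolynomial σ K) =
      LinearMap.mulLeft K (∑ i, X i) := by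
    exact LinearMap.ext fun p => by simp [Finset.sum_mul]
  refine mem_of_raising_pow_mem (E := ∑ i, LinearMap.mulLeft K (X i)) (F := ∑ i, lowering n i)
    (H := ∑ i, weighing n i) ?_ ?_ ?_ ((purePowerIdeal K n).restrictScalars K) ?_ ?_ ?_ s
    _ p (sum_weighing_apply n hp) ?_ ?_
  · rw [Finset.sum_mul_sum, Finset.sum_mul_sum]
    simp only [mulLeft_mul_lowering, Finset.sum_add_distrib, Finset.sum_ite_eq, Finset.mem_univ,
      if_true]
    rw [Finset.sum_comm]
  · rw [Finset.sum_mul_sum, Finset.sum_mul_sum, Finset.mul_sum]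
    simp only [weighing_mul_mulLeft, Finset.sum_add_distrib, Finset.sum_ite_eq, Finset.mem_univ,
      if_true]
    rw [Finset.sum_comm]
  · rw [Finset.sum_mul_sum, Finset.sum_mul_sum, Finset.mul_sum]
    simp only [weighing_mul_lowering, Finset.sum_sub_distrib, Finset.sum_ite_eq, Finset.mem_univ,
      if_true]
    rw [Finset.sum_comm]
  · intro v hv
    rw [hE]
    exact Ideal.mul_mem_left _ _ hv
  · intro v hv
    rw [LinearMap.sum_apply]
    exact Submodule.sum_mem _ fun i _ => lowering_mem_purePowerIdeal n i v hv
  · intro v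
    obtain ⟨N, hN⟩ := exists_sum_lowering_pow_eq_zero n v
    exact ⟨N, by rw [hN]; exact Submodule.zero_mem _⟩
  · zify at hks
    linarith
  · rw [hE, LinearMap.pow_mulLeft]
    exact h

end

end

noncomputable section

open MvPolynomial

/-- A matrix of polynomials which is injective at `0` is injective at almost every point. -/
theorem finite_setOf_not_injective_mulVec_eval {K m n : Type*} [Field K] [Fintype m] [Fintype n]
    (M : Matrix m n (Polynomial K))
    (h : ∀ v : n → K, Matrix.mulVec (M.map (Polynomial.eval 0)) v = 0 → v = 0) :
    {c : K | ¬ ∀ v : n → K, Matrix.mulVec (M.map (Polynomial.eval c)) v = 0 → v = 0}.Finite := by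
  classical
  obtain ⟨G, hG⟩ := (Matrix.mulVecLin (M.map (Polynomial.eval 0))).exists_leftInverse_of_injective
    (LinearMap.ker_eq_bot'.2 h)
  let P : Matrix n n (Polynomial K) := (LinearMap.toMatrix' G).map Polynomial.C * M
  have hP (c : K) : (Polynomial.evalRingHom c).mapMatrix P =
      LinearMap.toMatrix' G * M.map (Polynomial.eval c) := by
    ext i j
    simp [P, Matrix.mul_apply, Polynomial.eval_finsetSum]
  have hdet (c : K) : P.det.eval c = (LinearMap.toMatrix' G * M.map (Polynomial.eval c)).det := by
    rw [← hP, ← RingHom.map_det]; rfl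
  have h0 : P.det ≠ 0 := by
    intro hz
    have h1 := hdet 0
    have h2 : LinearMap.toMatrix' G * M.map (Polynomial.eval 0) = 1 := by
      rw [← LinearMap.toMatrix'_toLin' (M.map (Polynomial.eval 0)), ← LinearMap.toMatrix'_comp,
        Matrix.toLin'_apply', hG, LinearMap.toMatrix'_id]
    rw [hz, h2] at h1
    simp at h1
  refine (P.det.roots.toFinset.finite_toSet).subset fun c hc => ?_
  rw [Finset.mem_coe, Multiset.mem_toFinset, Polynomial.mem_roots h0, Polynomial.IsRoot.def]
  by_contra hne
  refine hc fun v hv => ?_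
  rw [hdet c] at hne
  have : IsUnit (LinearMap.toMatrix' G * M.map (Polynomial.eval c)) :=
    (Matrix.isUnit_iff_isUnit_det _).2 (isUnit_iff_ne_zero.2 hne)
  refine Matrix.mulVec_injective_of_isUnit this ?_
  simp only [← Matrix.mulVec_mulVec, hv, Matrix.mulVec_zero]

/-- The exponents of the standard monomials modulo `binomialIdeal K c d α`. -/
def normalExponents (d α : Fin 3 → ℕ) : Finset (Fin 3 → ℕ) :=
  (Fintype.piFinset fun i => Finset.range (d i)).filter fun b =>
    b 0 < d 0 - α 0 ∨ (b 1 < d 1 - α 1 ∧ b 2 < d 2 - α 2)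

theorem mem_normalExponents {d α b : Fin 3 → ℕ} : b ∈ normalExponents d α ↔
    b 0 < d 0 ∧ b 1 < d 1 ∧ b 2 < d 2 ∧
      (b 0 < d 0 - α 0 ∨ (b 1 < d 1 - α 1 ∧ b 2 < d 2 - α 2)) := by
  simp [normalExponents, Fin.forall_fin_succ, and_assoc]

/-- The relations of `binomialIdeal R (-c) d α` for three elements of a commutative algebra. -/
structure BinomialRelations {R B : Type*} [CommRing R] [CommRing B] [Algebra R B] (c : R)
    (d α : Fin 3 → ℕ) (y : Fin 3 → B) : Prop where
  binomial : y 0 ^ d 0 = c • (y 1 ^ α 1 * y 2 ^ α 2)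
  pow_one : y 1 ^ d 1 = 0
  pow_two : y 2 ^ d 2 = 0
  mul_one : y 0 ^ (d 0 - α 0) * y 1 ^ (d 1 - α 1) = 0
  mul_two : y 0 ^ (d 0 - α 0) * y 2 ^ (d 2 - α 2) = 0

/-- The matrix, in the basis of standard monomials, of the multiplication by the sum of the
variables modulo `binomialIdeal R (-c) d α`. -/
def shiftMatrix {R : Type*} [CommRing R] (d α : Fin 3 → ℕ) (c : R) :
    Matrix (normalExponents d α) (normalExponents d α) R := fun b' b =>
  (∑ i, if b'.1 = b.1 + Pi.single i 1 then 1 else 0) +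
    if b.1 0 + 1 = d 0 ∧ b'.1 = ![0, b.1 1 + α 1, b.1 2 + α 2] then c else 0

section Relations

variable {R B : Type*} [CommRing R] [CommRing B] [Algebra R B] {c : R} {d α : Fin 3 → ℕ}
  {y : Fin 3 → B}

theorem BinomialRelations.prod_eq_zero (hy : BinomialRelations c d α y) {b : Fin 3 → ℕ}
    (hb : d 1 ≤ b 1 ∨ d 2 ≤ b 2 ∨ (d 0 - α 0 ≤ b 0 ∧ (d 1 - α 1 ≤ b 1 ∨ d 2 - α 2 ≤ b 2))) :
    ∏ i, y i ^ b i = 0 := by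
  rw [Fin.prod_univ_three]
  have h0 {m n m' n' : ℕ} {u v : B} (h : u ^ m * v ^ n = 0) (hm : m ≤ m') (hn : n ≤ n') :
      u ^ m' * v ^ n' = 0 := by
    obtain ⟨k, rfl⟩ := Nat.exists_eq_add_of_le hm
    obtain ⟨l, rfl⟩ := Nat.exists_eq_add_of_le hn
    rw [pow_add, pow_add, mul_mul_mul_comm, h, zero_mul]
  rcases hb with h | h | ⟨h, h' | h'⟩
  · rw [pow_eq_zero_of_le h hy.pow_one]; ring
  · rw [pow_eq_zero_of_le h hy.pow_two]; ring
  · rw [h0 hy.mul_one h h', zero_mul]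
  · rw [mul_right_comm, h0 hy.mul_two h h', zero_mul]

theorem sum_normalExponents_ite (hy : BinomialRelations c d α y) (b : Fin 3 → ℕ) (hb : b 0 < d 0) :
    (∑ b' : normalExponents d α, if b'.1 = b then ∏ i, y i ^ b'.1 i else 0) =
      ∏ i, y i ^ b i := by
  by_cases h : b ∈ normalExponents d α
  · rw [Finset.sum_eq_single ⟨b, h⟩]
    · simp
    · rintro b' - hne
      rw [if_neg fun h' => hne (Subtype.ext h')]
    · simp
  · rw [Finset.sum_eq_zero, hy.prod_eq_zero]
    · rw [mem_normalExponents] at h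
      omega
    · intro b' _
      rw [if_neg]
      rintro rfl
      exact h b'.2

theorem prod_pow_add_single (y : Fin 3 → B) (b : Fin 3 → ℕ) (i : Fin 3) :
    ∏ j, y j ^ (b + Pi.single i 1 : Fin 3 → ℕ) j = y i * ∏ j, y j ^ b j := by
  have : ∏ j, y j ^ (Pi.single i 1 : Fin 3 → ℕ) j = y i := by
    rw [Finset.prod_eq_single i]
    · simp
    · intro j _ hj; simp [hj]
    · simp
  simp only [Pi.add_apply, pow_add, Finset.prod_mul_distrib, this, mul_comm]

theorem sum_shiftMatrix_smul (hy : BinomialRelations c d α y)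
    (b : normalExponents d α) :
    ∑ b', shiftMatrix d α c b' b • ∏ i, y i ^ b'.1 i = (∑ i, y i) * ∏ i, y i ^ b.1 i := by
  have hb := mem_normalExponents.1 b.2
  have hs (i : Fin 3) (hi : (b.1 + Pi.single i 1 : Fin 3 → ℕ) 0 < d 0) :
      (∑ b' : normalExponents d α, if b'.1 = b.1 + Pi.single i 1 then ∏ i, y i ^ b'.1 i else 0) =
        y i * ∏ i, y i ^ b.1 i := by
    rw [sum_normalExponents_ite hy _ hi, prod_pow_add_single]
  simp only [shiftMatrix, add_smul, ite_smul, one_smul, zero_smul,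
    Finset.sum_add_distrib, Fin.sum_univ_three, add_mul]
  rw [hs 1 (by simpa using hb.1), hs 2 (by simpa using hb.1)]
  by_cases h : b.1 0 + 1 = d 0
  · have h1 : (∑ b' : normalExponents d α,
        if b'.1 = b.1 + Pi.single 0 1 then ∏ i, y i ^ b'.1 i else 0) = 0 := by
      refine Finset.sum_eq_zero fun b' _ => if_neg fun h' => ?_
      have := (mem_normalExponents.1 b'.2).1
      rw [h'] at this
      simp at this
      omega
    have h2 := sum_normalExponents_ite hy ![0, b.1 1 + α 1, b.1 2 + α 2]
      (by simp only [Matrix.cons_val_zero]; omega)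
    simp only [Fin.prod_univ_three] at h1 h2 ⊢
    simp only [h, true_and, h1]
    have h3 := congrArg (fun x => c • x) h2
    simp only [Finset.smul_sum, smul_ite, smul_zero] at h3
    rw [h3]
    have h4 : y 0 * (y 0 ^ b.1 0 * y 1 ^ b.1 1 * y 2 ^ b.1 2) =
        y 0 ^ d 0 * (y 1 ^ b.1 1 * y 2 ^ b.1 2) := by
      rw [← h]; ring
    rw [h4, hy.binomial]
    simp [pow_add, Algebra.smul_def]
    ring
  · rw [hs 0 (by simp; omega)]
    simp [h]

/-- The element with coordinates `v` in the standard monomials. -/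
def normalSum (R : Type*) [CommRing R] [Algebra R B] (d α : Fin 3 → ℕ) (y : Fin 3 → B) :
    (normalExponents d α → R) →ₗ[R] B :=
  Fintype.linearCombination R fun b => ∏ i, y i ^ b.1 i

theorem normalSum_apply (y : Fin 3 → B) (v : normalExponents d α → R) :
    normalSum R d α y v = ∑ b, v b • ∏ i, y i ^ b.1 i := rfl

theorem map_normalSum {B' : Type*} [CommRing B'] [Algebra R B'] (f : B →ₐ[R] B') (y : Fin 3 → B)
    (v : normalExponents d α → R) :
    f (normalSum R d α y v) = normalSum R d α (fun i => f (y i)) v := by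
  simp [normalSum_apply]

theorem normalSum_shiftMatrix_mulVec (hy : BinomialRelations c d α y)
    (v : normalExponents d α → R) :
    normalSum R d α y (Matrix.mulVec (shiftMatrix d α c) v) =
      (∑ i, y i) * normalSum R d α y v := by
  simp only [normalSum_apply, Matrix.mulVec, dotProduct, Finset.sum_smul, Finset.mul_sum]
  rw [Finset.sum_comm]
  refine Finset.sum_congr rfl fun b _ => ?_
  rw [mul_smul_comm, ← sum_shiftMatrix_smul hy b, Finset.smul_sum]
  refine Finset.sum_congr rfl fun b' _ => ?_
  rw [smul_smul, mul_comm]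

theorem normalSum_shiftMatrix_pow_mulVec (hy : BinomialRelations c d α y)
    (v : normalExponents d α → R) (s : ℕ) :
    normalSum R d α y (Matrix.mulVec (shiftMatrix d α c ^ s) v) =
      (∑ i, y i) ^ s * normalSum R d α y v := by
  induction s with
  | zero => simp
  | succ s ih =>
    rw [pow_succ', ← Matrix.mulVec_mulVec, normalSum_shiftMatrix_mulVec hy, ih, pow_succ',
      mul_assoc]

end Relations

end

noncomputable section

open MvPolynomial

section Degenerate

variable {K : Type*} [Field K] {d α : Fin 3 → ℕ}

theorem mem_purePowerIdeal {σ : Type*} {n : σ → ℕ} {p : MvPolynomial σ K} :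
    p ∈ purePowerIdeal K n ↔ ∀ m ∈ p.support, ∃ i, n i ≤ m i := by
  have h : (Set.range fun i => (X i ^ n i : MvPolynomial σ K)) =
      (fun s => monomial s (1 : K)) '' Set.range fun i => Finsupp.single i (n i) := by
    rw [← Set.range_comp]
    congr 1
    funext i
    simp [X_pow_eq_monomial]
  rw [purePowerIdeal, h, mem_ideal_span_monomial_image]
  simp

/-- The exponents of the generators of the initial ideal of `binomialIdeal K c d α`. -/
def initialExponents (d α : Fin 3 → ℕ) : Set (Fin 3 →₀ ℕ) :=
  {Finsupp.single 0 (d 0), Finsupp.single 1 (d 1), Finsupp.single 2 (d 2),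
    Finsupp.single 0 (d 0 - α 0) + Finsupp.single 1 (d 1 - α 1),
    Finsupp.single 0 (d 0 - α 0) + Finsupp.single 2 (d 2 - α 2)}

/-- The monomial ideal to which `binomialIdeal K c d α` degenerates. -/
def initialIdeal (K : Type*) [Field K] (d α : Fin 3 → ℕ) : Ideal (MvPolynomial (Fin 3) K) :=
  Ideal.span ((fun s => monomial s (1 : K)) '' initialExponents d α)

theorem single_add_single_le_iff {i j : Fin 3} (hij : i ≠ j) {k l : ℕ} {m : Fin 3 →₀ ℕ} :
    Finsupp.single i k + Finsupp.single j l ≤ m ↔ k ≤ m i ∧ l ≤ m j := by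
  constructor
  · intro h
    have h1 := h i
    have h2 := h j
    simp [hij, hij.symm] at h1 h2
    exact ⟨h1, h2⟩
  · rintro ⟨h1, h2⟩ x
    by_cases hi : x = i
    · subst hi; simpa [hij.symm, hij] using h1
    · by_cases hj : x = j
      · subst hj; simpa [hij, hij.symm] using h2
      · simp [Ne.symm hi, Ne.symm hj]

theorem mem_initialIdeal {p : MvPolynomial (Fin 3) K} :
    p ∈ initialIdeal K d α ↔ ∀ m ∈ p.support,
      d 0 ≤ m 0 ∨ d 1 ≤ m 1 ∨ d 2 ≤ m 2 ∨
        (d 0 - α 0 ≤ m 0 ∧ d 1 - α 1 ≤ m 1) ∨ (d 0 - α 0 ≤ m 0 ∧ d 2 - α 2 ≤ m 2) := by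
  rw [initialIdeal, mem_ideal_span_monomial_image]
  simp only [initialExponents, Set.mem_insert_iff, Set.mem_singleton_iff, exists_eq_or_imp,
    exists_eq_left, Finsupp.single_le_iff,
    single_add_single_le_iff (show (0 : Fin 3) ≠ 1 by decide),
    single_add_single_le_iff (show (0 : Fin 3) ≠ 2 by decide)]

theorem binomialRelations_initialIdeal :
    BinomialRelations (0 : K) d α fun i => Ideal.Quotient.mk (initialIdeal K d α) (X i) := by
  have h {m : Fin 3 →₀ ℕ} (hm : m ∈ initialExponents d α) :
      monomial m (1 : K) ∈ initialIdeal K d α := Ideal.subset_span ⟨m, hm, rfl⟩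
  constructor
  · rw [zero_smul, ← map_pow, Ideal.Quotient.eq_zero_iff_mem, X_pow_eq_monomial]
    exact h (by simp [initialExponents])
  · rw [← map_pow, Ideal.Quotient.eq_zero_iff_mem, X_pow_eq_monomial]
    exact h (by simp [initialExponents])
  · rw [← map_pow, Ideal.Quotient.eq_zero_iff_mem, X_pow_eq_monomial]
    exact h (by simp [initialExponents])
  · rw [← map_pow, ← map_pow, ← map_mul, Ideal.Quotient.eq_zero_iff_mem, X_pow_eq_monomial,
      X_pow_eq_monomial, monomial_mul, one_mul]
    exact h (by simp [initialExponents])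
  · rw [← map_pow, ← map_pow, ← map_mul, Ideal.Quotient.eq_zero_iff_mem, X_pow_eq_monomial,
      X_pow_eq_monomial, monomial_mul, one_mul]
    exact h (by simp [initialExponents])

theorem prod_univ_X_pow_eq_monomial (b : Fin 3 → ℕ) :
    ∏ i, (X i : MvPolynomial (Fin 3) K) ^ b i = monomial (Finsupp.equivFunOnFinite.symm b) 1 := by
  rw [monomial_eq, Finsupp.prod_fintype _ _ (by simp)]
  simp

theorem coeff_normalSum_X (v : normalExponents d α → K) (b : normalExponents d α) :
    coeff (Finsupp.equivFunOnFinite.symm b.1) (normalSum K d α X v) = v b := by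
  classical
  rw [normalSum_apply, coeff_sum, Finset.sum_eq_single b]
  · simp [prod_univ_X_pow_eq_monomial]
  · intro b' _ hne
    rw [prod_univ_X_pow_eq_monomial, coeff_smul, coeff_monomial, if_neg, smul_zero]
    intro h
    exact hne (Subtype.ext (Finsupp.equivFunOnFinite.symm.injective h))
  · simp

/-- The strong Lefschetz property of the quotient by the initial ideal. -/
theorem shiftMatrix_zero_pow_mulVec_injective [CharZero K] (hα : ∀ j, α j ≤ d j)
    (hd : d 0 = α 1 + α 2) {k s : ℕ} (hks : s + 2 * k + 3 ≤ (d 0 - α 0) + d 1 + d 2)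
    {v : normalExponents d α → K} (hv : ∀ b, ∑ i, b.1 i ≠ k → v b = 0)
    (h : Matrix.mulVec (shiftMatrix d α 0 ^ s) v = 0) : v = 0 := by
  classical
  by_contra hv0
  obtain ⟨b₀, hb₀⟩ := Function.ne_iff.1 hv0
  set P : MvPolynomial (Fin 3) K := normalSum K d α X v with hP
  have hmem : (∑ i, X i) ^ s * P ∈ initialIdeal K d α := by
    rw [← Ideal.Quotient.eq_zero_iff_mem]
    have := normalSum_shiftMatrix_pow_mulVec (binomialRelations_initialIdeal (K := K)) v s
    rw [h, map_zero] at this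
    rw [map_mul, map_pow, map_sum, this]
    congr 1
    exact map_normalSum (Ideal.Quotient.mkₐ K (initialIdeal K d α)) X v
  have hhom : P.IsHomogeneous k := by
    rw [hP, normalSum_apply]
    refine IsHomogeneous.sum _ _ _ fun b _ => ?_
    by_cases hb : ∑ i, b.1 i = k
    · rw [prod_univ_X_pow_eq_monomial, smul_monomial]
      refine isHomogeneous_monomial _ ?_
      rw [Finsupp.degree_eq_sum]
      exact hb
    · rw [hv b hb, zero_smul]
      exact isHomogeneous_zero _ _ _
  have hsupp (b : normalExponents d α) (hb : v b ≠ 0) :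
      Finsupp.equivFunOnFinite.symm b.1 ∈ P.support := by
    rwa [mem_support_iff, coeff_normalSum_X]
  have hP1 : P ∈ purePowerIdeal K ![d 0 - α 0, d 1, d 2] := by
    refine mem_purePowerIdeal_of_sum_X_pow_mul (s := s) _ ?_ hhom ?_
    · simp [Fin.sum_univ_three]; omega
    · rw [mem_purePowerIdeal]
      rw [mem_initialIdeal] at hmem
      intro m hm
      have := hmem m hm
      simp only [Fin.exists_fin_succ]
      simp
      omega
  have hlow (b : normalExponents d α) (hb : v b ≠ 0) : d 0 - α 0 ≤ b.1 0 := by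
    obtain ⟨i, hi⟩ := mem_purePowerIdeal.1 hP1 _ (hsupp b hb)
    have := mem_normalExponents.1 b.2
    fin_cases i <;> simp at hi <;> omega
  obtain ⟨Q, hQ⟩ : ∃ Q : MvPolynomial (Fin 3) K, Q = ∑ b, v b •
      monomial (Finsupp.equivFunOnFinite.symm b.1 - Finsupp.single 0 (d 0 - α 0)) (1 : K) :=
    ⟨_, rfl⟩
  have hPQ : P = monomial (Finsupp.single 0 (d 0 - α 0)) 1 * Q := by
    rw [hP, hQ, normalSum_apply, Finset.mul_sum]
    refine Finset.sum_congr rfl fun b _ => ?_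
    by_cases hb : v b = 0
    · simp [hb]
    · rw [mul_smul_comm, monomial_mul, one_mul, prod_univ_X_pow_eq_monomial, add_tsub_cancel_of_le]
      simpa using hlow b hb
  have hQhom : Q.IsHomogeneous (k - (d 0 - α 0)) := by
    rw [hQ]
    refine IsHomogeneous.sum _ _ _ fun b _ => ?_
    by_cases hb : v b = 0
    · rw [hb, zero_smul]
      exact isHomogeneous_zero _ _ _
    · rw [smul_monomial]
      refine isHomogeneous_monomial _ ?_
      have h1 : ∑ i, b.1 i = k := by
        by_contra hne
        exact hb (hv b hne)
      have h2 := hlow b hb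
      rw [Finsupp.degree_eq_sum, ← h1]
      simp [Fin.sum_univ_three]
      omega
  have hQ2 : Q ∈ purePowerIdeal K ![α 0, d 1 - α 1, d 2 - α 2] := by
    refine mem_purePowerIdeal_of_sum_X_pow_mul (s := s) _ ?_ hQhom ?_
    · have h1 : ∑ i, b₀.1 i = k := by
        by_contra hne
        exact hb₀ (hv b₀ hne)
      have h2 := hlow b₀ hb₀
      have := hα 0
      have := hα 1
      have := hα 2
      simp [Fin.sum_univ_three] at h1 ⊢
      omega
    · rw [mem_purePowerIdeal]
      intro m hm
      rw [hPQ, mul_left_comm, mem_initialIdeal] at hmem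
      have := hmem (Finsupp.single 0 (d 0 - α 0) + m) (by
        rw [mem_support_iff] at hm ⊢
        rwa [coeff_monomial_mul, one_mul])
      have := hα 0
      simp only [Fin.exists_fin_succ]
      simp at this ⊢
      simp at *
      omega
  have h1 : Finsupp.equivFunOnFinite.symm b₀.1 - Finsupp.single 0 (d 0 - α 0) ∈ Q.support := by
    have h2 := hsupp b₀ hb₀
    have h3 : Finsupp.single 0 (d 0 - α 0) ≤ Finsupp.equivFunOnFinite.symm b₀.1 := by
      simpa using hlow b₀ hb₀
    rw [mem_support_iff] at h2 ⊢
    rw [hPQ, ← add_tsub_cancel_of_le h3, coeff_monomial_mul, one_mul] at h2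
    exact h2
  obtain ⟨i, hi⟩ := mem_purePowerIdeal.1 hQ2 _ h1
  have h2 := mem_normalExponents.1 b₀.2
  have h3 := hlow b₀ hb₀
  have := hα 0
  fin_cases i <;> simp at hi <;> omega

/-- For almost all `c` the powers of the sum of the variables are injective modulo
`binomialIdeal K (-c) d α` up to the reflected degree. -/
theorem finite_setOf_not_shiftMatrix_pow_injective [CharZero K] (hα : ∀ j, α j ≤ d j)
    (hd : d 0 = α 1 + α 2) {k s : ℕ} (hks : s + 2 * k + 3 ≤ (d 0 - α 0) + d 1 + d 2) :
    {c : K | ¬ ∀ v : normalExponents d α → K, (∀ b, ∑ i, b.1 i ≠ k → v b = 0) →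
      Matrix.mulVec (shiftMatrix d α c ^ s) v = 0 → v = 0}.Finite := by
  classical
  let D (R : Type _) [CommRing R] : Matrix (normalExponents d α) (normalExponents d α) R :=
    Matrix.diagonal fun b => if ∑ i, b.1 i = k then 0 else 1
  let M : Matrix (normalExponents d α ⊕ normalExponents d α) (normalExponents d α)
      (Polynomial K) := Matrix.fromRows (shiftMatrix d α Polynomial.X ^ s) (D _)
  have hM (c : K) : M.map (Polynomial.eval c) = Matrix.fromRows (shiftMatrix d α c ^ s) (D K) := by
    have h1 : (shiftMatrix d α (Polynomial.X : Polynomial K)).map (Polynomial.evalRingHom c) =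
        shiftMatrix d α c := by
      ext b' b
      simp only [shiftMatrix, Matrix.map_apply, map_add, map_sum, apply_ite (Polynomial.evalRingHom c),
        map_one, map_zero]
      simp
    have h2 : (shiftMatrix d α (Polynomial.X : Polynomial K) ^ s).map (Polynomial.evalRingHom c) =
        shiftMatrix d α c ^ s := by
      rw [← h1]
      exact map_pow (Polynomial.evalRingHom c).mapMatrix _ s
    ext (b' | b') b
    · rw [← h2]; rfl
    · simp only [M, D, Matrix.map_apply, Matrix.fromRows_apply_inr, Matrix.diagonal_apply]
      split_ifs <;> simp
  have hiff (c : K) : (∀ v, Matrix.mulVec (M.map (Polynomial.eval c)) v = 0 → v = 0) ↔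
      ∀ v : normalExponents d α → K, (∀ b, ∑ i, b.1 i ≠ k → v b = 0) →
      Matrix.mulVec (shiftMatrix d α c ^ s) v = 0 → v = 0 := by
    refine forall_congr' fun v => ?_
    have hz : Matrix.mulVec (D K) v = 0 ↔ ∀ b, ∑ i, b.1 i ≠ k → v b = 0 := by
      rw [funext_iff]
      refine forall_congr' fun b => ?_
      simp only [D, Matrix.mulVec_diagonal, Pi.zero_apply]
      split_ifs with hb <;> simp [hb]
    rw [hM, Matrix.fromRows_mulVec, ← hz]
    constructor
    · intro h h1 h2
      exact h (by rw [h1, h2]; exact Sum.elim_zero_zero)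
    · intro h h12
      refine h (funext fun b => congrFun h12 (Sum.inr b)) (funext fun b => congrFun h12 (Sum.inl b))
  refine (finite_setOf_not_injective_mulVec_eval M ((hiff 0).2 fun v hv h =>
    shiftMatrix_zero_pow_mulVec_injective hα hd hks hv h)).subset fun c hc h => hc ((hiff c).1 h)

theorem exists_ne_zero_shiftMatrix_pow_injective [CharZero K] (hα : ∀ j, α j ≤ d j)
    (hd : d 0 = α 1 + α 2) (h0 : 0 < d 0) :
    ∃ l : K, l ≠ 0 ∧ ∀ k s : ℕ, s + 2 * k + 3 ≤ (d 0 - α 0) + d 1 + d 2 →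
      ∀ v : normalExponents d α → K, (∀ b, ∑ i, b.1 i ≠ k → v b = 0) →
      Matrix.mulVec (shiftMatrix d α (l ^ d 0) ^ s) v = 0 → v = 0 := by
  obtain ⟨B, hB⟩ : ∃ B, B = (d 0 - α 0) + d 1 + d 2 := ⟨_, rfl⟩
  have hfin : (⋃ p ∈ {p : ℕ × ℕ | p.2 + 2 * p.1 + 3 ≤ B}, {c : K | ¬ ∀ v : normalExponents d α → K,
      (∀ b, ∑ i, b.1 i ≠ p.1 → v b = 0) →
      Matrix.mulVec (shiftMatrix d α c ^ p.2) v = 0 → v = 0}).Finite := by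
    refine Set.Finite.biUnion ?_ fun p hp =>
      finite_setOf_not_shiftMatrix_pow_injective hα hd (hB ▸ hp)
    refine (Set.finite_Iic ((B, B) : ℕ × ℕ)).subset fun p hp => ?_
    have hp' : p.2 + 2 * p.1 + 3 ≤ B := hp
    exact ⟨by simp; omega, by simp; omega⟩
  have hinj : Function.Injective fun t : ℕ => (((t + 1 : ℕ) : K)) ^ d 0 := by
    intro t t' h
    have h' : (t + 1) ^ d 0 = (t' + 1) ^ d 0 := by
      have : (((t + 1) ^ d 0 : ℕ) : K) = (((t' + 1) ^ d 0 : ℕ) : K) := by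
        push_cast at h ⊢; exact h
      exact_mod_cast this
    have := Nat.pow_left_injective h0.ne' h'
    omega
  obtain ⟨_, ⟨t, rfl⟩, ht⟩ := (Set.infinite_range_of_injective hinj).exists_notMem_finite hfin
  refine ⟨((t + 1 : ℕ) : K), Nat.cast_ne_zero.2 (Nat.succ_ne_zero t), fun k s hks => ?_⟩
  by_contra hcon
  exact ht (Set.mem_biUnion (x := (k, s)) (show s + 2 * k + 3 ≤ B by omega) hcon)

end Degenerate

end

noncomputable section

open MvPolynomial

section Presentation

variable {K A : Type*} [Field K] [CommRing A] [Algebra K A] {d α : Fin 3 → ℕ} {y : Fin 3 → A}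

theorem BinomialRelations.exists_normal (h0 : 0 < d 0) (hd : d 0 = α 1 + α 2)
    (hy : BinomialRelations (1 : K) d α y) (b : Fin 3 → ℕ) :
    ∏ i, y i ^ b i = 0 ∨
      ∃ b' ∈ normalExponents d α, ∑ i, b' i = ∑ i, b i ∧ ∏ i, y i ^ b' i = ∏ i, y i ^ b i := by
  obtain ⟨n, hn⟩ : ∃ n, b 0 = n := ⟨_, rfl⟩
  induction n using Nat.strong_induction_on generalizing b with
  | _ n ih =>
    by_cases hb : b 0 < d 0
    · by_cases hN : b ∈ normalExponents d α
      · exact Or.inr ⟨b, hN, rfl, rfl⟩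
      · refine Or.inl (hy.prod_eq_zero ?_)
        rw [mem_normalExponents] at hN
        omega
    · obtain ⟨k, hk⟩ := Nat.exists_eq_add_of_le (not_lt.1 hb)
      have h1 : ∏ i, y i ^ (![k, b 1 + α 1, b 2 + α 2] i) = ∏ i, y i ^ b i := by
        simp only [Fin.prod_univ_three, Matrix.cons_val, hk, pow_add, hy.binomial, one_smul]
        ring
      have h2 : ∑ i, (![k, b 1 + α 1, b 2 + α 2] i) = ∑ i, b i := by
        simp only [Fin.sum_univ_three, Matrix.cons_val]
        omega
      have := ih k (by omega) ![k, b 1 + α 1, b 2 + α 2] rfl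
      rwa [h1, h2] at this

theorem BinomialRelations.exists_normalSum_eq (h0 : 0 < d 0) (hd : d 0 = α 1 + α 2)
    (hy : BinomialRelations (1 : K) d α y) (T : Set ℕ) {a : A}
    (ha : a ∈ Submodule.span K ((fun b : Fin 3 → ℕ => ∏ i, y i ^ b i) '' {b | ∑ i, b i ∈ T})) :
    ∃ v : normalExponents d α → K, (∀ b, ∑ i, b.1 i ∉ T → v b = 0) ∧ normalSum K d α y v = a := by
  classical
  induction ha using Submodule.span_induction with
  | mem a ha =>
    obtain ⟨b, hb, rfl⟩ := ha
    rcases hy.exists_normal h0 hd b with h | ⟨b', hb', hdeg, h⟩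
    · exact ⟨0, fun _ _ => rfl, by rw [map_zero]; exact h.symm⟩
    · refine ⟨Pi.single ⟨b', hb'⟩ 1, fun b'' hb'' => ?_, ?_⟩
      · rw [Pi.single_eq_of_ne]
        rintro rfl
        exact hb'' (hdeg.symm ▸ hb : ∑ i, b' i ∈ T)
      · simp only [normalSum, Fintype.linearCombination_apply_single, one_smul, h]
  | zero => exact ⟨0, fun _ _ => rfl, map_zero _⟩
  | add a a' _ _ h h' =>
    obtain ⟨v, hv, rfl⟩ := h
    obtain ⟨v', hv', rfl⟩ := h'
    exact ⟨v + v', fun b hb => by simp [hv b hb, hv' b hb], map_add _ _ _⟩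
  | smul c a _ h =>
    obtain ⟨v, hv, rfl⟩ := h
    exact ⟨c • v, fun b hb => by simp [hv b hb], map_smul _ _ _⟩

theorem map_aeval_homogeneousSubmodule (y : Fin 3 → A) (k : ℕ) :
    (homogeneousSubmodule (Fin 3) K k).map (aeval y).toLinearMap =
      Submodule.span K ((fun b : Fin 3 → ℕ => ∏ i, y i ^ b i) '' {b | ∑ i, b i = k}) := by
  have h (m : Fin 3 →₀ ℕ) (c : K) : aeval y (monomial m c) = c • ∏ i, y i ^ m i := by
    rw [aeval_monomial, Finsupp.prod_fintype _ _ (by simp), Algebra.smul_def]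
  apply le_antisymm
  · rintro _ ⟨p, hp, rfl⟩
    rw [AlgHom.toLinearMap_apply, p.as_sum, map_sum]
    refine Submodule.sum_mem _ fun m hm => ?_
    rw [h]
    refine Submodule.smul_mem _ _ (Submodule.subset_span ⟨m, ?_, rfl⟩)
    have := hp (mem_support_iff.1 hm)
    exact (Finsupp.degree_eq_sum m).symm.trans
      ((DFunLike.congr_fun Finsupp.degree_eq_weight_one m).trans this)
  · rw [Submodule.span_le]
    rintro _ ⟨b, hb, rfl⟩
    refine ⟨monomial (Finsupp.equivFunOnFinite.symm b) 1, isHomogeneous_monomial _ ?_, ?_⟩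
    · rw [Finsupp.degree_eq_sum]; exact hb
    · rw [AlgHom.toLinearMap_apply, h]; simp

theorem binomialRelations_binomialIdeal : BinomialRelations (1 : K) d α fun i =>
    Ideal.Quotient.mk (binomialIdeal K (-1) d α) (X i) := by
  constructor
  · rw [one_smul, ← sub_eq_zero]
    simp only [← map_pow, ← map_mul, ← map_sub]
    rw [Ideal.Quotient.eq_zero_iff_mem]
    exact Ideal.subset_span (Or.inl (by simp; ring))
  all_goals
    simp only [← map_pow, ← map_mul]
    rw [Ideal.Quotient.eq_zero_iff_mem]
    exact Ideal.subset_span (by simp)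

theorem BinomialRelations.binomialIdeal_le_ker (hy : BinomialRelations (1 : K) d α y) :
    binomialIdeal K (-1) d α ≤ RingHom.ker (aeval (R := K) y) := by
  refine Ideal.span_le.2 ?_
  rintro p (rfl | rfl | rfl | rfl | rfl) <;>
    simp [RingHom.mem_ker, hy.binomial, hy.pow_one, hy.pow_two, hy.mul_one, hy.mul_two]

variable {𝒜 : ℕ → Submodule K A}

/-- An algebra spanned by monomials in three elements which satisfy the relations of
`binomialIdeal K (-1) d α` and whose standard monomials are independent is the quotient by that
ideal. -/
theorem exists_algEquiv_binomialIdeal (h0 : 0 < d 0) (hd : d 0 = α 1 + α 2)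
    (hy : BinomialRelations (1 : K) d α y)
    (hgr : ∀ k, 𝒜 k =
      Submodule.span K ((fun b : Fin 3 → ℕ => ∏ i, y i ^ b i) '' {b | ∑ i, b i = k}))
    (htop : Submodule.span K (Set.range fun b : Fin 3 → ℕ => ∏ i, y i ^ b i) = ⊤)
    (hli : LinearIndependent K fun b : normalExponents d α => ∏ i, y i ^ b.1 i) :
    ∃ e : A ≃ₐ[K] (MvPolynomial (Fin 3) K ⧸ binomialIdeal K (-1) d α),
      ∀ i, (𝒜 i).map e.toLinearMap = quotientGrading (binomialIdeal K (-1) d α) i := by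
  let f : (MvPolynomial (Fin 3) K ⧸ binomialIdeal K (-1) d α) →ₐ[K] A :=
    Ideal.Quotient.liftₐ _ (aeval y) fun p hp => hy.binomialIdeal_le_ker hp
  have hf (p) : f (Ideal.Quotient.mk _ p) = aeval y p := rfl
  have hsurj : Function.Surjective f := by
    rw [← AlgHom.coe_toLinearMap, ← LinearMap.range_eq_top, eq_top_iff, ← htop, Submodule.span_le]
    rintro _ ⟨b, rfl⟩
    refine ⟨Ideal.Quotient.mk _ (∏ i, X i ^ b i), ?_⟩
    rw [AlgHom.toLinearMap_apply, hf]
    simp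
  have hinj : Function.Injective f := by
    rw [injective_iff_map_eq_zero]
    intro q hq
    obtain ⟨p, rfl⟩ := Ideal.Quotient.mk_surjective q
    have hspan : Ideal.Quotient.mk (binomialIdeal K (-1) d α) p ∈
        Submodule.span K ((fun b : Fin 3 → ℕ => ∏ i,
          (fun i => Ideal.Quotient.mk (binomialIdeal K (-1) d α) (X i)) i ^ b i) ''
            {b | ∑ i, b i ∈ Set.univ}) := by
      rw [← Ideal.Quotient.mkₐ_eq_mk K, p.as_sum, map_sum]
      refine Submodule.sum_mem _ fun m _ => ?_
      have : monomial m (coeff m p) = coeff m p • ∏ i, X i ^ m i := by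
        rw [prod_univ_X_pow_eq_monomial, smul_monomial]
        simp
      rw [this, map_smul]
      refine Submodule.smul_mem _ _ (Submodule.subset_span ⟨m, trivial, ?_⟩)
      simp
    obtain ⟨v, -, hv⟩ := binomialRelations_binomialIdeal.exists_normalSum_eq h0 hd _ hspan
    rw [← hv] at hq ⊢
    rw [map_normalSum] at hq
    have hq' : normalSum K d α y v = 0 := by
      simpa [hf] using hq
    have : v = 0 := by
      funext b
      exact Fintype.linearIndependent_iff.1 hli v hq' b
    rw [this, map_zero]
  let e := AlgEquiv.ofBijective f ⟨hinj, hsurj⟩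
  refine ⟨e.symm, fun i => ?_⟩
  have h1 : (quotientGrading (binomialIdeal K (-1) d α) i).map f.toLinearMap = 𝒜 i := by
    rw [hgr, ← map_aeval_homogeneousSubmodule, quotientGrading, ← Submodule.map_comp]
    rfl
  rw [← h1, ← Submodule.map_comp]
  have : e.symm.toLinearMap ∘ₗ f.toLinearMap = LinearMap.id :=
    LinearMap.ext fun x => e.symm_apply_apply x
  rw [this, Submodule.map_id]

/-- The reflection of the standard monomials. -/
theorem card_normalExponents_filter (hα : ∀ j, α j ≤ d j) (hd : d 0 = α 1 + α 2) {k l : ℕ}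
    (hkl : k + l + 3 = (d 0 - α 0) + d 1 + d 2) :
    ((normalExponents d α).filter fun b => ∑ i, b i = k).card =
      ((normalExponents d α).filter fun b => ∑ i, b i = l).card := by
  have := hα 0
  have := hα 1
  have := hα 2
  let r (b : Fin 3 → ℕ) : Fin 3 → ℕ :=
    if b 0 < d 0 - α 0 then ![d 0 - α 0 - 1 - b 0, d 1 - 1 - b 1, d 2 - 1 - b 2]
    else ![(d 0 - α 0) + (d 0 - 1 - b 0), d 1 - α 1 - 1 - b 1, d 2 - α 2 - 1 - b 2]
  have hr {k l : ℕ} (hkl : k + l + 3 = (d 0 - α 0) + d 1 + d 2) {b : Fin 3 → ℕ}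
      (hb : b ∈ (normalExponents d α).filter fun b => ∑ i, b i = k) :
      r b ∈ (normalExponents d α).filter fun b => ∑ i, b i = l := by
    simp only [Finset.mem_filter, mem_normalExponents, Fin.sum_univ_three] at hb ⊢
    simp only [r]
    split_ifs <;> simp only [Matrix.cons_val] <;> omega
  have hrr {k : ℕ} {b : Fin 3 → ℕ} (hb : b ∈ (normalExponents d α).filter fun b => ∑ i, b i = k) :
      r (r b) = b := by
    simp only [Finset.mem_filter, mem_normalExponents, Fin.sum_univ_three] at hb
    funext i
    by_cases h : b 0 < d 0 - α 0
    · have h' : d 0 - α 0 - 1 - b 0 < d 0 - α 0 := by omega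
      fin_cases i <;> simp [r, h, h'] <;> omega
    · fin_cases i <;> simp [r, h] <;> omega
  exact Finset.card_nbij' r r (fun b hb => hr hkl hb) (fun b hb => hr (by omega) hb)
    (fun b hb => hrr hb) (fun b hb => hrr hb)

theorem BinomialRelations.finrank_eq (h0 : 0 < d 0) (hd : d 0 = α 1 + α 2)
    (hy : BinomialRelations (1 : K) d α y)
    (hgr : ∀ k, 𝒜 k =
      Submodule.span K ((fun b : Fin 3 → ℕ => ∏ i, y i ^ b i) '' {b | ∑ i, b i = k}))
    (hli : LinearIndependent K fun b : normalExponents d α => ∏ i, y i ^ b.1 i) (k : ℕ) :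
    FiniteDimensional K (𝒜 k) ∧
      Module.finrank K (𝒜 k) = ((normalExponents d α).filter fun b => ∑ i, b i = k).card := by
  let g (b : ↥((normalExponents d α).filter fun b => ∑ i, b i = k)) : A := ∏ i, y i ^ b.1 i
  let ι (b : ↥((normalExponents d α).filter fun b => ∑ i, b i = k)) : normalExponents d α :=
    ⟨b.1, (Finset.mem_filter.1 b.2).1⟩
  have hι : Function.Injective ι := fun b b' h =>
    Subtype.ext (congrArg (fun x : normalExponents d α => x.1) h)
  have hg : LinearIndependent K g := hli.comp ι hι
  have hspan : 𝒜 k = Submodule.span K (Set.range g) := by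
    rw [hgr]
    apply le_antisymm
    · rw [Submodule.span_le]
      rintro _ ⟨b, hb, rfl⟩
      rcases hy.exists_normal h0 hd b with h | ⟨b', hb', hdeg, h⟩
      · simp only [h]; exact Submodule.zero_mem _
      · simp only [← h]
        exact Submodule.subset_span ⟨⟨b', Finset.mem_filter.2 ⟨hb', hdeg.trans hb⟩⟩, rfl⟩
    · refine Submodule.span_mono ?_
      rintro _ ⟨b, rfl⟩
      exact ⟨b.1, (Finset.mem_filter.1 b.2).2, rfl⟩
  rw [hspan]
  exact ⟨FiniteDimensional.span_of_finite K (Set.finite_range g),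
    (finrank_span_eq_card hg).trans (Fintype.card_coe _)⟩

theorem hasSLP_of_binomialRelations [CharZero K] (h0 : 0 < d 0) (hα : ∀ j, α j ≤ d j)
    (hd : d 0 = α 1 + α 2) (hy : BinomialRelations (1 : K) d α y)
    (hgr : ∀ k, 𝒜 k =
      Submodule.span K ((fun b : Fin 3 → ℕ => ∏ i, y i ^ b i) '' {b | ∑ i, b i = k}))
    (hli : LinearIndependent K fun b : normalExponents d α => ∏ i, y i ^ b.1 i) :
    HasSLP 𝒜 := by
  obtain ⟨l, hl, hinj⟩ := exists_ne_zero_shiftMatrix_pow_injective (K := K) hα hd h0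
  let y' : Fin 3 → A := ![l • y 0, y 1, y 2]
  have hy' : BinomialRelations (l ^ d 0) d α y' := by
    constructor <;> simp only [y', Matrix.cons_val, smul_pow, smul_mul_assoc, hy.binomial,
      hy.pow_one, hy.pow_two, hy.mul_one, hy.mul_two, one_smul, smul_zero]
  have hmem1 (i : Fin 3) : y i ∈ 𝒜 1 := by
    rw [hgr]
    refine Submodule.subset_span ⟨Pi.single i 1, by simp, ?_⟩
    have := prod_pow_add_single y 0 i
    simpa using this
  have hℓ : ∑ i, y' i ∈ 𝒜 1 := by
    rw [Fin.sum_univ_three]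
    exact add_mem (add_mem (Submodule.smul_mem _ _ (hmem1 0)) (hmem1 1)) (hmem1 2)
  have hmul1 {k : ℕ} {a : A} (i : Fin 3) (ha : a ∈ 𝒜 k) : y i * a ∈ 𝒜 (k + 1) := by
    rw [hgr] at ha ⊢
    induction ha using Submodule.span_induction with
    | mem a ha =>
      obtain ⟨b, hb, rfl⟩ := ha
      refine Submodule.subset_span ⟨b + Pi.single i 1, ?_, prod_pow_add_single y b i⟩
      have hb' : ∑ j, b j = k := hb
      simp [Finset.sum_add_distrib, hb']
    | zero => simp
    | add a a' _ _ h h' => rw [mul_add]; exact add_mem h h'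
    | smul c a _ h => rw [mul_smul_comm]; exact Submodule.smul_mem _ _ h
  have hmul (s : ℕ) {k : ℕ} {a : A} (ha : a ∈ 𝒜 k) : (∑ i, y' i) ^ s * a ∈ 𝒜 (k + s) := by
    induction s with
    | zero => simpa using ha
    | succ s ih =>
      rw [pow_succ', mul_assoc, Fin.sum_univ_three, add_mul, add_mul]
      rw [Fin.sum_univ_three] at ih
      refine add_mem (add_mem ?_ (hmul1 1 ih)) (hmul1 2 ih)
      rw [show y' 0 = l • y 0 from rfl, smul_mul_assoc]
      exact Submodule.smul_mem _ _ (hmul1 0 ih)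
  have hscale (v : normalExponents d α → K) :
      normalSum K d α y' v = normalSum K d α y fun b => l ^ b.1 0 * v b := by
    simp only [normalSum_apply]
    refine Finset.sum_congr rfl fun b _ => ?_
    simp only [Fin.prod_univ_three, y', Matrix.cons_val, smul_pow, smul_mul_assoc, smul_smul,
      mul_comm]
  have hinjOn {k s : ℕ} (hks : s + 2 * k + 3 ≤ (d 0 - α 0) + d 1 + d 2) :
      Set.InjOn (fun a => (∑ i, y' i) ^ s * a) (𝒜 k : Set A) := by
    intro a ha a' ha' haa
    have hsub : a - a' ∈ 𝒜 k := sub_mem ha ha'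
    rw [hgr] at hsub
    obtain ⟨v, hv, hva⟩ := hy.exists_normalSum_eq h0 hd {k} hsub
    have hz (w : normalExponents d α → K) (hw : normalSum K d α y w = 0) : w = 0 :=
      funext fun b => Fintype.linearIndependent_iff.1 hli w hw b
    obtain ⟨u, hu⟩ : ∃ u : normalExponents d α → K, u = fun b => (l ^ b.1 0)⁻¹ * v b := ⟨_, rfl⟩
    have huv : normalSum K d α y' u = a - a' := by
      rw [hscale, ← hva, hu]
      congr 1
      funext b
      rw [mul_inv_cancel_left₀ (pow_ne_zero _ hl)]
    have h1 : normalSum K d α y' (Matrix.mulVec (shiftMatrix d α (l ^ d 0) ^ s) u) = 0 := by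
      rw [normalSum_shiftMatrix_pow_mulVec hy', huv, mul_sub]
      exact sub_eq_zero.2 haa
    rw [hscale] at h1
    have h2 : Matrix.mulVec (shiftMatrix d α (l ^ d 0) ^ s) u = 0 := by
      funext b
      have := congrFun (hz _ h1) b
      exact (mul_eq_zero.1 this).resolve_left (pow_ne_zero _ hl)
    have h3 := hinj k s hks u (fun b hb => by rw [hu]; simp [hv b hb]) h2
    rw [h3, map_zero] at huv
    exact (sub_eq_zero.1 huv.symm)
  refine ⟨∑ i, y' i, hℓ, fun k s => ?_⟩
  by_cases hks : s + 2 * k + 3 ≤ (d 0 - α 0) + d 1 + d 2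
  · exact Or.inl (hinjOn hks)
  · right
    intro z hz
    by_cases hlarge : k + s + 3 ≤ (d 0 - α 0) + d 1 + d 2
    · obtain ⟨k', hk'⟩ := Nat.exists_eq_add_of_le hlarge
      obtain ⟨r, hr⟩ : ∃ r, k = k' + r := Nat.exists_eq_add_of_le (by omega)
      obtain ⟨hfd, hrank⟩ := hy.finrank_eq h0 hd hgr hli k'
      obtain ⟨hfd', hrank'⟩ := hy.finrank_eq h0 hd hgr hli (k + s)
      have heq : k' + (r + s) = k + s := by omega
      let f : 𝒜 k' →ₗ[K] 𝒜 (k + s) :=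
        ((LinearMap.mulLeft K ((∑ i, y' i) ^ (r + s))).comp (𝒜 k').subtype).codRestrict _
          fun a => heq ▸ hmul (r + s) a.2
      have hf : Function.Injective f := by
        intro a a' h
        exact Subtype.ext (hinjOn (s := r + s) (by omega) a.2 a'.2 (congrArg Subtype.val h))
      have hf' : Function.Surjective f :=
        (LinearMap.injective_iff_surjective_of_finrank_eq_finrank
          (by rw [hrank, hrank']; exact card_normalExponents_filter hα hd (by omega))).1 hf
      obtain ⟨x, hx⟩ := hf' ⟨z, hz⟩
      refine ⟨(∑ i, y' i) ^ r * x, hr ▸ hmul r x.2, ?_⟩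
      have := congrArg Subtype.val hx
      simp only [← mul_assoc, ← pow_add, add_comm s r]
      exact this
    · refine ⟨0, Submodule.zero_mem _, ?_⟩
      rw [SetLike.mem_coe, hgr] at hz
      obtain ⟨v, hv, hvz⟩ := hy.exists_normalSum_eq h0 hd {k + s} hz
      have : v = 0 := by
        funext b
        refine hv b fun hb => ?_
        have h1 := mem_normalExponents.1 b.2
        have h2 : ∑ i, b.1 i = k + s := hb
        rw [Fin.sum_univ_three] at h2
        have := hα 0
        have := hα 1
        have := hα 2
        omega
      simp only [mul_zero]
      rw [← hvz, this, map_zero]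

end Presentation

end

noncomputable section

/-- An algebra with a basis of monomials in three elements `y`, in which the monomials `y ^ b` are
graded by `∑ bᵢ` and separated by the weight `∑ bᵢ gᵢ`, and where the nonzero monomials are the
divisors of the monomials with the degree and the weight of `y ^ a`. -/
structure MonomialPresentation {K A : Type*} [Field K] [CommRing A] [Algebra K A]
    (𝒜 : ℕ → Submodule K A) (y : Fin 3 → A) (g a : Fin 3 → ℕ) : Prop where
  grading : ∀ k, 𝒜 k =
    Submodule.span K ((fun b : Fin 3 → ℕ => ∏ i, y i ^ b i) '' {b | ∑ i, b i = k})
  span_eq_top : Submodule.span K (Set.range fun b : Fin 3 → ℕ => ∏ i, y i ^ b i) = ⊤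
  ne_zero_iff : ∀ b : Fin 3 → ℕ, ∏ i, y i ^ b i ≠ 0 ↔
    ∃ a' : Fin 3 → ℕ, b ≤ a' ∧ ∑ i, a' i = ∑ i, a i ∧ ∑ i, a' i * g i = ∑ i, a i * g i
  eq_of_weight_eq : ∀ b b' : Fin 3 → ℕ, ∏ i, y i ^ b i ≠ 0 → ∏ i, y i ^ b' i ≠ 0 →
    ∑ i, b i * g i = ∑ i, b' i * g i → ∏ i, y i ^ b i = ∏ i, y i ^ b' i
  linearIndependent : ∀ N : Finset (Fin 3 → ℕ), (∀ b ∈ N, ∏ i, y i ^ b i ≠ 0) →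
    (∀ b ∈ N, ∀ b' ∈ N, ∑ i, b i = ∑ i, b' i → ∑ i, b i * g i = ∑ i, b' i * g i → b = b') →
      LinearIndependent K fun b : N => ∏ i, y i ^ b.1 i

namespace MonomialPresentation

variable {K A : Type*} [Field K] [CommRing A] [Algebra K A] {𝒜 : ℕ → Submodule K A}
  {y : Fin 3 → A} {g a : Fin 3 → ℕ}

theorem congr_top (h : MonomialPresentation 𝒜 y g a) {a' : Fin 3 → ℕ}
    (h1 : ∑ i, a' i = ∑ i, a i) (h2 : ∑ i, a' i * g i = ∑ i, a i * g i) :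
    MonomialPresentation 𝒜 y g a' :=
  { h with ne_zero_iff := fun b => by rw [h1, h2]; exact h.ne_zero_iff b }

theorem perm (h : MonomialPresentation 𝒜 y g a) (σ : Equiv.Perm (Fin 3)) :
    MonomialPresentation 𝒜 (y ∘ σ) (g ∘ σ) (a ∘ σ) := by
  have hp (b : Fin 3 → ℕ) : ∏ i, (y ∘ σ) i ^ b i = ∏ i, y i ^ (b ∘ σ.symm) i := by
    rw [← Equiv.prod_comp σ fun i => y i ^ (b ∘ σ.symm) i]
    simp
  have hs (b : Fin 3 → ℕ) : ∑ i, b i = ∑ i, (b ∘ σ.symm) i := (Equiv.sum_comp σ.symm b).symm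
  have hw (b : Fin 3 → ℕ) : ∑ i, b i * (g ∘ σ) i = ∑ i, (b ∘ σ.symm) i * g i := by
    rw [← Equiv.sum_comp σ fun i => (b ∘ σ.symm) i * g i]
    simp
  have ha : (a ∘ σ) ∘ σ.symm = a := by
    funext i; simp
  have hback (b : Fin 3 → ℕ) : (b ∘ σ) ∘ σ.symm = b := by
    funext i; simp
  refine ⟨fun k => ?_, ?_, fun b => ?_, fun b b' => ?_, fun N hN hNN => ?_⟩
  · rw [h.grading]
    congr 1
    ext x
    constructor
    · rintro ⟨b, hb, rfl⟩
      exact ⟨b ∘ σ, by rw [Set.mem_ofPred_eq, hs, hback]; exact hb, by simp only [hp, hback]⟩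
    · rintro ⟨b, hb, rfl⟩
      exact ⟨b ∘ σ.symm, by rw [Set.mem_ofPred_eq, ← hs]; exact hb, by simp only [hp]⟩
  · rw [← h.span_eq_top]
    congr 1
    ext x
    constructor
    · rintro ⟨b, rfl⟩
      exact ⟨b ∘ σ.symm, by simp only [hp]⟩
    · rintro ⟨b, rfl⟩
      exact ⟨b ∘ σ, by simp only [hp, hback]⟩
  · rw [hp, h.ne_zero_iff]
    constructor
    · rintro ⟨a', h1, h2, h3⟩
      refine ⟨a' ∘ σ, fun i => by simpa using h1 (σ i), ?_, ?_⟩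
      · rw [hs, hs (a ∘ σ), hback, ha, h2]
      · rw [hw, hw, hback, ha, h3]
    · rintro ⟨a', h1, h2, h3⟩
      refine ⟨a' ∘ σ.symm, fun i => h1 (σ.symm i), ?_, ?_⟩
      · rw [← hs, h2, hs, ha]
      · rw [← hw, h3, hw, ha]
  · rw [hp, hp, hw, hw]
    exact h.eq_of_weight_eq _ _
  · classical
    have hinj : Function.Injective fun b : Fin 3 → ℕ => b ∘ σ.symm :=
      σ.symm.surjective.injective_comp_right
    have := h.linearIndependent (N.image fun b => b ∘ σ.symm) (by
      intro b hb
      obtain ⟨c, hc, rfl⟩ := Finset.mem_image.1 hb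
      rw [← hp]; exact hN c hc) (by
      intro b hb b' hb' h1 h2
      obtain ⟨c, hc, rfl⟩ := Finset.mem_image.1 hb
      obtain ⟨c', hc', rfl⟩ := Finset.mem_image.1 hb'
      rw [hNN c hc c' hc' (by rw [hs, hs c', h1]) (by rw [hw, hw, h2])])
    have h2 := this.comp (fun b : N => (⟨b.1 ∘ σ.symm, Finset.mem_image_of_mem _ b.2⟩ :
      ↥(N.image fun b => b ∘ σ.symm))) (fun b b' hb =>
        Subtype.ext (hinj (congrArg (fun x : ↥(N.image fun b => b ∘ σ.symm) => x.1) hb)))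
    convert h2 using 1
    funext b
    exact hp b.1

theorem exists_binomialRelations_of_unique (h : MonomialPresentation 𝒜 y g a)
    (huniq : ∀ a' : Fin 3 → ℕ, ∑ i, a' i = ∑ i, a i → ∑ i, a' i * g i = ∑ i, a i * g i → a' = a)
    (h10 : a 1 ≤ a 0) (h02 : a 0 ≤ a 2) :
    ∃ d α : Fin 3 → ℕ, 0 < d 0 ∧ (∀ j, α j ≤ d j) ∧ d 0 = α 1 + α 2 ∧
      BinomialRelations (1 : K) d α y ∧
        LinearIndependent K fun b : normalExponents d α => ∏ i, y i ^ b.1 i := by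
  have hz (b : Fin 3 → ℕ) (i : Fin 3) (hb : a i < b i) : ∏ i, y i ^ b i = 0 := by
    by_contra hne
    obtain ⟨a', h1, h2, h3⟩ := (h.ne_zero_iff b).1 hne
    rw [huniq a' h2 h3] at h1
    exact absurd (h1 i) (not_le.2 hb)
  have hzi (i : Fin 3) {k : ℕ} (hk : a i < k) : y i ^ k = 0 := by
    have := hz (Pi.single i k) i (by simpa using hk)
    rwa [Finset.prod_eq_single i (fun j _ hj => by simp [hj]) (by simp), Pi.single_eq_same] at this
  refine ⟨fun i => a i + 1, ![0, a 1 + 1, a 0 - a 1], Nat.succ_pos _, ?_, ?_, ?_, ?_⟩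
  · intro j
    fin_cases j <;> simp
    omega
  · simp; omega
  · constructor
    · simp [hzi 0 (Nat.lt_succ_self _), hzi 1 (Nat.lt_succ_self _)]
    · exact hzi 1 (Nat.lt_succ_self _)
    · exact hzi 2 (Nat.lt_succ_self _)
    · simp [hzi 0 (Nat.lt_succ_self _)]
    · simp [hzi 0 (Nat.lt_succ_self _)]
  · have hle (b : Fin 3 → ℕ) (hb : b ∈ normalExponents (fun i => a i + 1)
        ![0, a 1 + 1, a 0 - a 1]) : b ≤ a := by
      have := mem_normalExponents.1 hb
      intro i
      fin_cases i
      · exact Nat.lt_succ_iff.1 this.1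
      · exact Nat.lt_succ_iff.1 this.2.1
      · exact Nat.lt_succ_iff.1 this.2.2.1
    refine h.linearIndependent _ (fun b hb => (h.ne_zero_iff b).2 ⟨a, hle b hb, rfl, rfl⟩) ?_
    intro b hb b' hb' h1 h2
    have e1 (i : Fin 3) : b i ≤ a i := hle b hb i
    have := huniq (fun i => a i - b i + b' i) (by
      have := e1 0; have := e1 1; have := e1 2
      simp only [Fin.sum_univ_three] at h1 ⊢; omega) (by
      have h3 (i : Fin 3) : (a i - b i + b' i) * g i + b i * g i = a i * g i + b' i * g i := by
        rw [← add_mul, ← add_mul]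
        congr 1
        have := e1 i
        omega
      have h4 := h3 0
      have h5 := h3 1
      have h6 := h3 2
      simp only [Fin.sum_univ_three] at h2 ⊢
      omega)
    funext i
    have h3 := congrFun this i
    have := e1 i
    omega

/-- The lattice of the vectors of degree and weight zero is generated by
`(p' + q', -q', -p')`. -/
theorem exists_eq_add_smul {g : Fin 3 → ℕ} (h10 : g 1 < g 0) (h02 : g 0 < g 2) :
    ∃ p q : ℕ, 0 < p ∧ 0 < q ∧ q * (g 0 - g 1) = p * (g 2 - g 0) ∧
      ∀ b b' : Fin 3 → ℕ, ∑ i, b i = ∑ i, b' i → ∑ i, b i * g i = ∑ i, b' i * g i →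
        ∃ t : ℤ, (b' 0 : ℤ) = b 0 + t * (q + p) ∧ (b' 1 : ℤ) = b 1 - t * q ∧
          (b' 2 : ℤ) = b 2 - t * p := by
  obtain ⟨P, hP⟩ := Nat.exists_eq_add_of_lt h10
  obtain ⟨Q, hQ⟩ := Nat.exists_eq_add_of_lt h02
  obtain ⟨c, p, q, hc, hcop, hp, hq⟩ := Nat.exists_coprime' (m := P + 1) (n := Q + 1)
    (Nat.gcd_pos_of_pos_left _ (Nat.succ_pos _))
  have hp0 : 0 < p := Nat.pos_of_ne_zero fun h => by simp [h] at hp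
  have hq0 : 0 < q := Nat.pos_of_ne_zero fun h => by simp [h] at hq
  refine ⟨p, q, hp0, hq0, ?_, ?_⟩
  · rw [show g 0 - g 1 = P + 1 by omega, show g 2 - g 0 = Q + 1 by omega, hp, hq]
    ring
  · intro b b' h1 h2
    simp only [Fin.sum_univ_three] at h1 h2
    have hg0 : (g 0 : ℤ) = g 1 + p * c := by
      have : g 0 = g 1 + p * c := by omega
      exact_mod_cast this
    have hg2 : (g 2 : ℤ) = g 0 + q * c := by
      have : g 2 = g 0 + q * c := by omega
      exact_mod_cast this
    zify at h1 h2
    have hc' : (c : ℤ) ≠ 0 := by exact_mod_cast hc.ne'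
    have h3 : ((b 1 : ℤ) - b' 1) * p = ((b 2 : ℤ) - b' 2) * q := by
      apply mul_right_cancel₀ hc'
      rw [hg2, hg0] at h2
      linear_combination (g 1 + p * c : ℤ) * h1 - h2
    have hdvd : (q : ℤ) ∣ (b 1 : ℤ) - b' 1 := by
      have : (q : ℤ) ∣ ((b 1 : ℤ) - b' 1) * p := ⟨_, h3.trans (mul_comm _ _)⟩
      exact (Nat.isCoprime_iff_coprime.2 hcop.symm).dvd_of_dvd_mul_right this
    obtain ⟨t, ht⟩ := hdvd
    have hq' : (q : ℤ) ≠ 0 := by exact_mod_cast hq0.ne'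
    have h4 : (b 2 : ℤ) - b' 2 = t * p := by
      apply mul_right_cancel₀ hq'
      rw [← h3, ht]; ring
    exact ⟨t, by linear_combination -h1 + ht + h4, by linear_combination -ht,
      by linear_combination -h4⟩

theorem exists_binomialRelations (h : MonomialPresentation 𝒜 y g a) (hg : Function.Injective g) :
    ∃ (d α : Fin 3 → ℕ) (y' : Fin 3 → A) (g' a' : Fin 3 → ℕ), MonomialPresentation 𝒜 y' g' a' ∧
      0 < d 0 ∧ (∀ j, α j ≤ d j) ∧ d 0 = α 1 + α 2 ∧
      BinomialRelations (1 : K) d α y' ∧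
        LinearIndependent K fun b : normalExponents d α => ∏ i, y' i ^ b.1 i := by
  -- a permutation which brings a triple into the order `f 1 ≤ f 0 ≤ f 2`
  have hsort (f : Fin 3 → ℕ) : ∃ σ : Equiv.Perm (Fin 3), f (σ 1) ≤ f (σ 0) ∧ f (σ 0) ≤ f (σ 2) := by
    have hm := Tuple.monotone_sort f
    refine ⟨(Equiv.swap 0 1).trans (Tuple.sort f), ?_, ?_⟩
    · have := hm (show (0 : Fin 3) ≤ 1 by decide)
      simpa using this
    · have := hm (show (1 : Fin 3) ≤ 2 by decide)
      have e : Equiv.swap (0 : Fin 3) 1 2 = 2 := by decide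
      simpa [e] using this
  obtain ⟨σ, hσ1, hσ2⟩ := hsort g
  have hgσ : Function.Injective (g ∘ σ) := hg.comp σ.injective
  replace h := h.perm σ
  obtain ⟨g', hg'⟩ : ∃ g', g' = g ∘ σ := ⟨_, rfl⟩
  obtain ⟨y', hy'⟩ : ∃ y', y' = y ∘ σ := ⟨_, rfl⟩
  obtain ⟨a₀, ha₀⟩ : ∃ a₀, a₀ = a ∘ σ := ⟨_, rfl⟩
  rw [← hg', ← hy', ← ha₀] at h
  have h10 : g' 1 < g' 0 := lt_of_le_of_ne (by rw [hg']; exact hσ1)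
    (by rw [hg']; exact hgσ.ne (by decide))
  have h02 : g' 0 < g' 2 := lt_of_le_of_ne (by rw [hg']; exact hσ2)
    (by rw [hg']; exact hgσ.ne (by decide))
  obtain ⟨p, q, hp, hq, hpq, hlat⟩ := exists_eq_add_smul h10 h02
  have hmin : ∃ n, ∃ b : Fin 3 → ℕ, b 0 = n ∧ ∑ i, b i = ∑ i, a₀ i ∧
      ∑ i, b i * g' i = ∑ i, a₀ i * g' i := ⟨_, a₀, rfl, rfl, rfl⟩
  classical
  obtain ⟨b, hb0, hb1, hb2⟩ := Nat.find_spec hmin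
  have hbmin (b' : Fin 3 → ℕ) (h1 : ∑ i, b' i = ∑ i, b i)
      (h2 : ∑ i, b' i * g' i = ∑ i, b i * g' i) : b 0 ≤ b' 0 := by
    rw [hb0]
    exact Nat.find_min' hmin ⟨b', rfl, h1.trans hb1, h2.trans hb2⟩
  replace h := h.congr_top hb1 hb2
  clear hb0 hb1 hb2 hmin
  have hshift (c : Fin 3 → ℕ) :
      (∑ i, ![c 0, c 1 + q, c 2 + p] i = ∑ i, ![c 0 + (q + p), c 1, c 2] i) ∧
      ∑ i, ![c 0, c 1 + q, c 2 + p] i * g' i = ∑ i, ![c 0 + (q + p), c 1, c 2] i * g' i := by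
    constructor
    · simp [Fin.sum_univ_three]; ring
    · obtain ⟨P, hP⟩ := Nat.exists_eq_add_of_lt h10
      obtain ⟨Q, hQ⟩ := Nat.exists_eq_add_of_lt h02
      have e1 : g' 0 - g' 1 = P + 1 := by omega
      have e2 : g' 2 - g' 0 = Q + 1 := by omega
      rw [e1, e2] at hpq
      simp only [Fin.sum_univ_three, Matrix.cons_val, hQ]
      rw [hP]
      zify at hpq ⊢
      linear_combination -hpq
  have hblt : b 0 < q + p := by
    by_contra hcon
    obtain ⟨k, hk⟩ := Nat.exists_eq_add_of_le (not_lt.1 hcon)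
    obtain ⟨e1, e2⟩ := hshift ![k, b 1, b 2]
    have e3 : ![k + (q + p), b 1, b 2] = b := by
      funext i
      fin_cases i
      · simp; omega
      · rfl
      · rfl
    simp only [Matrix.cons_val] at e1 e2
    rw [e3] at e1 e2
    have := hbmin _ e1 e2
    simp at this
    omega
  have hpar (b' : Fin 3 → ℕ) (h1 : ∑ i, b' i = ∑ i, b i)
      (h2 : ∑ i, b' i * g' i = ∑ i, b i * g' i) :
      ∃ t : ℕ, b' 0 = b 0 + t * (q + p) ∧ b' 1 + t * q = b 1 ∧ b' 2 + t * p = b 2 := by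
    obtain ⟨t, t0, t1, t2⟩ := hlat b b' h1.symm h2.symm
    have ht : 0 ≤ t := by
      by_contra hneg
      have : t * (q + p) ≤ -(q + p : ℤ) := by nlinarith
      have : (b 0 : ℤ) < q + p := by exact_mod_cast hblt
      omega
    lift t to ℕ using ht
    refine ⟨t, by exact_mod_cast t0, ?_, ?_⟩
    · zify; linarith
    · zify; linarith
  by_cases hcase : q ≤ b 1 ∧ p ≤ b 2
  · have hprod3 (k0 k1 k2 : ℕ) : ∏ i, y' i ^ ![k0, k1, k2] i = y' 0 ^ k0 * y' 1 ^ k1 * y' 2 ^ k2 := by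
      simp [Fin.prod_univ_three]
    have hzero (k : Fin 3 → ℕ) (hk : ∀ t : ℕ, ∀ b' : Fin 3 → ℕ, k ≤ b' → b' 0 = b 0 + t * (q + p) →
        b' 1 + t * q = b 1 → b' 2 + t * p = b 2 → False) : ∏ i, y' i ^ k i = 0 := by
      by_contra hne
      obtain ⟨a', h1, h2, h3⟩ := (h.ne_zero_iff k).1 hne
      obtain ⟨t, t0, t1, t2⟩ := hpar a' h2 h3
      exact hk t a' h1 t0 t1 t2
    refine ⟨![q + p, b 1 + 1, b 2 + 1], ![q + p - (b 0 + 1), q, p], y', g', b, h, ?_, ?_, ?_, ?_, ?_⟩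
    · simp; omega
    · intro j
      fin_cases j
      · simp
      · simp; omega
      · simp; omega
    · simp
    · have he : q + p - (q + p - (b 0 + 1)) = b 0 + 1 := by omega
      constructor
      · simp only [Matrix.cons_val, one_smul]
        have e1 := hprod3 (q + p) 0 0
        have e2 := hprod3 0 q p
        simp only [pow_zero, mul_one, one_mul] at e1 e2
        rw [← e1, ← e2]
        have hiff : ∏ i, y' i ^ ![q + p, 0, 0] i ≠ 0 ↔ ∏ i, y' i ^ ![0, q, p] i ≠ 0 := by
          rw [h.ne_zero_iff, h.ne_zero_iff]
          constructor
          · rintro ⟨a', h1, h2, h3⟩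
            obtain ⟨k, hk⟩ := Nat.exists_eq_add_of_le (h1 0)
            simp only [Matrix.cons_val] at hk
            obtain ⟨s1, s2⟩ := hshift ![k, a' 1, a' 2]
            have e3 : ![k + (q + p), a' 1, a' 2] = a' := by
              funext i
              fin_cases i
              · simp; omega
              · rfl
              · rfl
            simp only [Matrix.cons_val] at s1 s2
            rw [e3] at s1 s2
            refine ⟨_, ?_, s1.trans h2, s2.trans h3⟩
            intro i
            fin_cases i <;> simp
          · rintro ⟨a', h1, h2, h3⟩
            obtain ⟨k, hk⟩ := Nat.exists_eq_add_of_le (h1 1)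
            obtain ⟨l, hl⟩ := Nat.exists_eq_add_of_le (h1 2)
            simp only [Matrix.cons_val] at hk hl
            obtain ⟨s1, s2⟩ := hshift ![a' 0, k, l]
            have e3 : ![a' 0, k + q, l + p] = a' := by
              funext i
              fin_cases i
              · rfl
              · simp; omega
              · simp; omega
            simp only [Matrix.cons_val] at s1 s2
            rw [e3] at s1 s2
            refine ⟨_, ?_, s1.symm.trans h2, s2.symm.trans h3⟩
            intro i
            fin_cases i <;> simp
        by_cases hne : ∏ i, y' i ^ ![q + p, 0, 0] i = 0
        · rw [hne]
          exact (not_not.1 fun hh => hiff.2 hh hne).symm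
        · refine h.eq_of_weight_eq _ _ hne (hiff.1 hne) ?_
          have := (hshift ![0, 0, 0]).2
          simpa using this.symm
      · have := hzero ![0, b 1 + 1, 0] (fun t b' hb' t0 t1 t2 => by
          have := hb' 1
          simp at this
          omega)
        rw [hprod3] at this
        simpa using this
      · have := hzero ![0, 0, b 2 + 1] (fun t b' hb' t0 t1 t2 => by
          have := hb' 2
          simp at this
          omega)
        rw [hprod3] at this
        simpa using this
      · have := hzero ![b 0 + 1, b 1 + 1 - q, 0] (fun t b' hb' t0 t1 t2 => by
          have h3 := hb' 0
          have h4 := hb' 1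
          simp only [Matrix.cons_val] at h3 h4
          rcases t with _ | t
          · omega
          · have : (t + 1) * q = t * q + q := by ring
            omega)
        rw [hprod3] at this
        simpa [he] using this
      · have := hzero ![b 0 + 1, 0, b 2 + 1 - p] (fun t b' hb' t0 t1 t2 => by
          have h3 := hb' 0
          have h4 := hb' 2
          simp only [Matrix.cons_val] at h3 h4
          rcases t with _ | t
          · omega
          · have : (t + 1) * p = t * p + p := by ring
            omega)
        rw [hprod3] at this
        simpa [he] using this
    · refine h.linearIndependent _ (fun c hc => ?_) (fun c hc c' hc' h1 h2 => ?_)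
      · have hc := mem_normalExponents.1 hc
        simp only [Matrix.cons_val] at hc
        rw [h.ne_zero_iff]
        by_cases hlow : c 0 ≤ b 0
        · refine ⟨b, ?_, rfl, rfl⟩
          intro i
          fin_cases i
          · exact hlow
          · simp; omega
          · simp; omega
        · obtain ⟨k, hk⟩ := Nat.exists_eq_add_of_le hcase.1
          obtain ⟨l, hl⟩ := Nat.exists_eq_add_of_le hcase.2
          obtain ⟨s1, s2⟩ := hshift ![b 0, k, l]
          have e3 : ![b 0, k + q, l + p] = b := by
            funext i
            fin_cases i
            · rfl
            · simp; omega
            · simp; omega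
          simp only [Matrix.cons_val] at s1 s2
          rw [e3] at s1 s2
          refine ⟨_, ?_, s1.symm, s2.symm⟩
          intro i
          fin_cases i <;> simp <;> omega
      · have hc := (mem_normalExponents.1 hc).1
        have hc' := (mem_normalExponents.1 hc').1
        simp only [Matrix.cons_val] at hc hc'
        obtain ⟨t, t0, t1, t2⟩ := hlat c c' h1 h2
        have ht : t = 0 := by
          by_contra hne
          rcases lt_or_gt_of_ne hne with hlt | hgt
          · have : t * (q + p) ≤ -(q + p : ℤ) := by nlinarith
            omega
          · have : (q + p : ℤ) ≤ t * (q + p) := by nlinarith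
            omega
        subst ht
        funext i
        fin_cases i <;> simp <;> omega
  · have huniq (a' : Fin 3 → ℕ) (h1 : ∑ i, a' i = ∑ i, b i)
        (h2 : ∑ i, a' i * g' i = ∑ i, b i * g' i) : a' = b := by
      obtain ⟨t, t0, t1, t2⟩ := hpar a' h1 h2
      rcases t with _ | t
      · funext i
        fin_cases i <;> simp <;> omega
      · exfalso
        have e1 : (t + 1) * q = t * q + q := by ring
        have e2 : (t + 1) * p = t * p + p := by ring
        omega
    obtain ⟨τ, hτ1, hτ2⟩ := hsort b
    have hτ := h.perm τ
    obtain ⟨d, α, h1, h2, h3, h4, h5⟩ := hτ.exists_binomialRelations_of_unique (by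
      intro a' e1 e2
      have := huniq (a' ∘ τ.symm) (by
        rw [← Equiv.sum_comp τ b]
        exact (Equiv.sum_comp τ.symm a').trans e1) (by
        rw [← Equiv.sum_comp τ fun i => b i * g' i, ← Equiv.sum_comp τ]
        simpa using e2)
      rw [← this]
      funext i
      simp) hτ1 hτ2
    exact ⟨d, α, _, _, _, hτ, h1, h2, h3, h4, h5⟩

theorem hasSLP_and_exists_algEquiv [CharZero K] (h : MonomialPresentation 𝒜 y g a)
    (hg : Function.Injective g) :
    HasSLP 𝒜 ∧
      ∃ d α : Fin 3 → ℕ, (∀ j, α j ≤ d j) ∧ d 0 = α 1 + α 2 ∧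
        ∃ e : A ≃ₐ[K] (MvPolynomial (Fin 3) K ⧸ binomialIdeal K (-1) d α),
          ∀ i, (𝒜 i).map e.toLinearMap = quotientGrading (binomialIdeal K (-1) d α) i := by
  obtain ⟨d, α, y', g', a', h', h0, hα, hd, hy, hli⟩ := h.exists_binomialRelations hg
  exact ⟨hasSLP_of_binomialRelations h0 hα hd hy h'.grading hli, d, α, hα, hd,
    exists_algEquiv_binomialIdeal h0 hd hy h'.grading h'.span_eq_top hli⟩

end MonomialPresentation

end

noncomputable section

/-- `s` is the sum of `i` nonzero elements of `S` and an element of `S`. -/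
def OrderGE (S : AddSubmonoid ℕ) : ℕ → ℕ → Prop
  | 0, s => s ∈ S
  | i + 1, s => ∃ a ∈ S, a ≠ 0 ∧ ∃ b, OrderGE S i b ∧ s = a + b

namespace OrderGE

variable {S : AddSubmonoid ℕ} {i j s t : ℕ}

theorem mem (h : OrderGE S i s) : s ∈ S := by
  induction i generalizing s with
  | zero => exact h
  | succ i ih =>
    obtain ⟨a, ha, -, b, hb, rfl⟩ := h
    exact S.add_mem ha (ih hb)

theorem mem_add (hs : s ∈ S) (h : OrderGE S j t) : OrderGE S j (s + t) := by
  cases j with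
  | zero => exact S.add_mem hs h
  | succ j =>
    obtain ⟨a, ha, ha0, b, hb, rfl⟩ := h
    exact ⟨s + a, S.add_mem hs ha, by omega, b, hb, by omega⟩

theorem add (h : OrderGE S i s) (h' : OrderGE S j t) : OrderGE S (i + j) (s + t) := by
  induction i generalizing s with
  | zero => simpa using mem_add h h'
  | succ i ih =>
    obtain ⟨a, ha, ha0, b, hb, rfl⟩ := h
    rw [show i + 1 + j = i + j + 1 by omega]
    exact ⟨a, ha, ha0, b + t, ih hb, by omega⟩

theorem of_le (hij : i ≤ j) (h : OrderGE S j s) : OrderGE S i s := by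
  induction hij with
  | refl => exact h
  | step _ ih =>
    obtain ⟨a, ha, -, b, hb, rfl⟩ := h
    exact ih (mem_add ha hb)

theorem le (h : OrderGE S i s) : i ≤ s := by
  induction i generalizing s with
  | zero => exact Nat.zero_le _
  | succ i ih =>
    obtain ⟨a, ha, ha0, b, hb, rfl⟩ := h
    have := ih hb
    omega

theorem one_iff : OrderGE S 1 s ↔ s ∈ S ∧ s ≠ 0 := by
  constructor
  · intro h
    exact ⟨h.mem, by have := h.le; omega⟩
  · rintro ⟨h, h0⟩
    exact ⟨s, h, h0, 0, S.zero_mem, rfl⟩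

end OrderGE

/-- `s` lies in the Apéry set and has order `i`. -/
def HasAperyOrder (S : AddSubmonoid ℕ) (n i s : ℕ) : Prop :=
  s ∈ aperySet S n ∧ OrderGE S i s ∧ ¬ OrderGE S (i + 1) s

namespace HasAperyOrder

variable {S : AddSubmonoid ℕ} {n i j s : ℕ}

theorem unique (h : HasAperyOrder S n i s) (h' : HasAperyOrder S n j s) : i = j := by
  by_contra hne
  rcases lt_or_gt_of_ne hne with hlt | hgt
  · exact h.2.2 (h'.2.1.of_le hlt)
  · exact h'.2.2 (h.2.1.of_le hgt)

theorem eq_zero (h : HasAperyOrder S n 0 s) : s = 0 := by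
  by_contra h0
  exact h.2.2 (OrderGE.one_iff.2 ⟨h.2.1, h0⟩)

theorem zero (hn : n ≠ 0) : HasAperyOrder S n 0 0 := by
  refine ⟨⟨S.zero_mem, ?_⟩, S.zero_mem, ?_⟩
  · rintro ⟨u, -, hu⟩
    omega
  · rw [OrderGE.one_iff]
    simp

theorem exists_eq_add (h : HasAperyOrder S n (i + 1) s) :
    ∃ a b, HasAperyOrder S n 1 a ∧ HasAperyOrder S n i b ∧ s = a + b := by
  obtain ⟨hap, ⟨a, ha, ha0, b, hb, rfl⟩, hmax⟩ := h
  refine ⟨a, b, ⟨⟨ha, ?_⟩, OrderGE.one_iff.2 ⟨ha, ha0⟩, fun h2 => hmax ?_⟩,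
    ⟨⟨hb.mem, ?_⟩, hb, fun h2 => hmax ⟨a, ha, ha0, b, h2, rfl⟩⟩, rfl⟩
  · rintro ⟨u, hu, rfl⟩
    exact hap.2 ⟨u + b, S.add_mem hu hb.mem, by omega⟩
  · have := h2.add hb
    rwa [show 1 + 1 + i = i + 1 + 1 by omega] at this
  · rintro ⟨u, hu, rfl⟩
    exact hap.2 ⟨a + u, S.add_mem ha hu, by omega⟩

end HasAperyOrder

theorem aperySet_bounded {S : AddSubmonoid ℕ} (hS : IsNumericalSemigroup S) (n : ℕ) :
    ∃ B, ∀ s ∈ aperySet S n, s ≤ B := by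
  obtain ⟨N, hN⟩ := hS.bddAbove
  refine ⟨N + n, fun s hs => ?_⟩
  by_contra hlt
  refine hs.2 ⟨s - n, ?_, by omega⟩
  by_contra hmem
  have : s - n ≤ N := hN hmem
  omega

section SemigroupRing

variable (K : Type*) [Field K] (S : AddSubmonoid ℕ) (n : ℕ)

/-- The class of `t ^ s` in `AperyRing K S n`. -/
def aperyMonomial (s : S) : AperyRing K S n :=
  Ideal.Quotient.mk (aperyIdeal K S n) (semigroupMonomial K S s)

variable {K S n}

theorem semigroupMonomial_add (s t : S) :
    semigroupMonomial K S (s + t) = semigroupMonomial K S s * semigroupMonomial K S t := by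
  simp [semigroupMonomial, AddMonoidAlgebra.single_mul_single]

theorem aperyMonomial_add (s t : S) :
    aperyMonomial K S n (s + t) = aperyMonomial K S n s * aperyMonomial K S n t := by
  rw [aperyMonomial, semigroupMonomial_add, map_mul]; rfl

theorem aperyMonomial_zero : aperyMonomial K S n 0 = 1 := rfl

theorem aperyMonomial_nsmul (k : ℕ) (s : S) :
    aperyMonomial K S n (k • s) = aperyMonomial K S n s ^ k := by
  induction k with
  | zero => rw [zero_smul, pow_zero, aperyMonomial_zero]
  | succ k ih => rw [succ_nsmul, pow_succ, aperyMonomial_add, ih]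

theorem mem_span_semigroupMonomial {T : Set S} {f : AddMonoidAlgebra K S} :
    f ∈ Ideal.span (semigroupMonomial K S '' T) ↔
      ∀ s ∈ f.coeff.support, ∃ t ∈ T, ∃ u, s = u + t :=
  AddMonoidAlgebra.mem_ideal_span_of'_image

theorem coeff_eq_zero_of_mem_aperyIdeal {f : AddMonoidAlgebra K S} (hf : f ∈ aperyIdeal K S n)
    {s : S} (hs : (s : ℕ) ∈ aperySet S n) : f.coeff s = 0 := by
  by_contra hne
  obtain ⟨t, ht, u, rfl⟩ := mem_span_semigroupMonomial.1 hf s (Finsupp.mem_support_iff.2 hne)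
  refine ht ⟨t.2, ?_⟩
  rintro ⟨v, hv, htv⟩
  exact hs.2 ⟨u + v, S.add_mem u.2 hv, by rw [AddSubmonoid.coe_add, htv]; omega⟩

theorem aperyMaximalIdeal_pow (i : ℕ) : aperyMaximalIdeal K S n ^ i =
    (Ideal.span (semigroupMonomial K S '' {s : S | OrderGE S i s})).map
      (Ideal.Quotient.mk (aperyIdeal K S n)) := by
  rw [aperyMaximalIdeal, ← Ideal.map_pow]
  congr 1
  induction i with
  | zero =>
    rw [pow_zero, Ideal.one_eq_top, eq_comm, Ideal.eq_top_iff_one]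
    exact Ideal.subset_span ⟨0, S.zero_mem, rfl⟩
  | succ i ih =>
    rw [pow_succ', ih, Ideal.span_mul_span']
    congr 1
    ext f
    constructor
    · rintro ⟨_, ⟨a, ha, rfl⟩, _, ⟨b, hb, rfl⟩, rfl⟩
      refine ⟨a + b, ⟨a, a.2, fun h => ha (Subtype.ext h), b, hb, rfl⟩, ?_⟩
      exact semigroupMonomial_add a b
    · rintro ⟨s, ⟨a, ha, ha0, b, hb, hs⟩, rfl⟩
      refine ⟨_, ⟨⟨a, ha⟩, fun h => ha0 (congrArg Subtype.val h), rfl⟩, _,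
        ⟨⟨b, hb.mem⟩, hb, rfl⟩, ?_⟩
      have : s = ⟨a, ha⟩ + ⟨b, hb.mem⟩ := Subtype.ext hs
      rw [this]
      exact (semigroupMonomial_add _ _).symm

theorem aperyMonomial_mem_pow {i : ℕ} {s : S} (h : OrderGE S i s) :
    aperyMonomial K S n s ∈ aperyMaximalIdeal K S n ^ i := by
  rw [aperyMaximalIdeal_pow]
  exact Ideal.mem_map_of_mem _ (Ideal.subset_span ⟨s, h, rfl⟩)

theorem exists_mk_eq_of_mem_pow {i : ℕ} {x : AperyRing K S n}
    (hx : x ∈ aperyMaximalIdeal K S n ^ i) :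
    ∃ f : AddMonoidAlgebra K S, Ideal.Quotient.mk (aperyIdeal K S n) f = x ∧
      ∀ s ∈ f.coeff.support, OrderGE S i s := by
  rw [aperyMaximalIdeal_pow] at hx
  obtain ⟨f, hf, rfl⟩ := (Ideal.mem_map_iff_of_surjective _ Ideal.Quotient.mk_surjective).1 hx
  refine ⟨f, rfl, fun s hs => ?_⟩
  obtain ⟨t, ht, u, rfl⟩ := mem_span_semigroupMonomial.1 hf s hs
  exact OrderGE.mem_add u.2 ht

theorem coeff_eq_zero_of_mk_mem_pow {i : ℕ} {f : AddMonoidAlgebra K S}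
    (hf : Ideal.Quotient.mk (aperyIdeal K S n) f ∈ aperyMaximalIdeal K S n ^ i) {s : S}
    (hs : (s : ℕ) ∈ aperySet S n) (hi : ¬ OrderGE S i s) : f.coeff s = 0 := by
  obtain ⟨f', hf', hsupp⟩ := exists_mk_eq_of_mem_pow hf
  have h := coeff_eq_zero_of_mem_aperyIdeal (Ideal.Quotient.eq.1 hf') hs
  have h' : f'.coeff s = 0 := by
    by_contra hne
    exact hi (hsupp s (Finsupp.mem_support_iff.2 hne))
  rw [AddMonoidAlgebra.coeff_sub, Finsupp.sub_apply, h', zero_sub, neg_eq_zero] at h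
  exact h

theorem mk_eq_sum (f : AddMonoidAlgebra K S) : Ideal.Quotient.mk (aperyIdeal K S n) f =
    ∑ s ∈ f.coeff.support, f.coeff s • aperyMonomial K S n s := by
  have h : f = ∑ s ∈ f.coeff.support, f.coeff s • semigroupMonomial K S s := by
    apply AddMonoidAlgebra.coeff_injective
    ext s
    simp [semigroupMonomial, Finsupp.single_apply, AddMonoidAlgebra.coeff_sum]
  conv_lhs => rw [h]
  rw [← Ideal.Quotient.mkₐ_eq_mk K, map_sum]
  simp only [map_smul]
  rfl

end SemigroupRing

section AssociatedGraded

variable {Q : Type*} [CommRing Q] {I : Ideal Q}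

theorem coeff_mem_pow_succ_of_mem_map {x : reesAlgebra I}
    (hx : x ∈ I.map (algebraMap Q (reesAlgebra I))) : ∀ i, x.1.coeff i ∈ I ^ (i + 1) := by
  refine Submodule.span_induction (p := fun x _ => ∀ i, x.1.coeff i ∈ I ^ (i + 1)) ?_ ?_ ?_ ?_ hx
  · rintro _ ⟨a, ha, rfl⟩ i
    change (Polynomial.C a).coeff i ∈ _
    rw [Polynomial.coeff_C]
    split_ifs with h
    · subst h; simpa using ha
    · exact Ideal.zero_mem _
  · exact fun i => Ideal.zero_mem _
  · intro x y _ _ hx hy i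
    change (x.1 + y.1).coeff i ∈ _
    rw [Polynomial.coeff_add]
    exact Ideal.add_mem _ (hx i) (hy i)
  · intro a x _ hx i
    change (a.1 * x.1).coeff i ∈ _
    rw [Polynomial.coeff_mul]
    refine Ideal.sum_mem _ fun p hp => ?_
    rw [← Finset.HasAntidiagonal.mem_antidiagonal.1 hp, add_assoc, pow_add]
    exact Ideal.mul_mem_mul (a.2 p.1) (hx p.2)

theorem monomial_mem_map {i : ℕ} {r : Q} (hr : r ∈ I ^ (i + 1))
    (h : Polynomial.monomial i r ∈ reesAlgebra I) :
    (⟨Polynomial.monomial i r, h⟩ : reesAlgebra I) ∈ I.map (algebraMap Q (reesAlgebra I)) := by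
  suffices H : ∃ x ∈ I.map (algebraMap Q (reesAlgebra I)), x.1 = Polynomial.monomial i r by
    obtain ⟨x, hx, hxr⟩ := H
    have : (⟨Polynomial.monomial i r, h⟩ : reesAlgebra I) = x := Subtype.ext hxr.symm
    rwa [this]
  rw [pow_succ'] at hr
  refine Submodule.mul_induction_on hr (fun a ha b hb => ?_) fun x y hx hy => ?_
  · refine ⟨algebraMap Q (reesAlgebra I) a *
      ⟨Polynomial.monomial i b, reesAlgebra.monomial_mem.2 hb⟩,
      Ideal.mul_mem_right _ _ (Ideal.mem_map_of_mem _ ha), ?_⟩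
    change Polynomial.C a * Polynomial.monomial i b = _
    rw [Polynomial.C_mul_monomial]
  · obtain ⟨u, hu, hux⟩ := hx
    obtain ⟨v, hv, hvy⟩ := hy
    refine ⟨u + v, Ideal.add_mem _ hu hv, ?_⟩
    change u.1 + v.1 = _
    rw [hux, hvy, map_add]

variable {K : Type*} [Field K] [Algebra K Q]

theorem associatedGradedMk_eq_zero {x : reesAlgebra I} :
    associatedGradedMk K I x = 0 ↔ x ∈ I.map (algebraMap Q (reesAlgebra I)) :=
  Ideal.Quotient.eq_zero_iff_mem

theorem associatedGradedMk_surjective : Function.Surjective (associatedGradedMk K I) :=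
  Ideal.Quotient.mk_surjective

theorem mem_associatedGradedPiece {i : ℕ} {a : AssociatedGradedRing I} :
    a ∈ associatedGradedPiece K I i ↔ ∃ (r : Q) (h : Polynomial.monomial i r ∈ reesAlgebra I),
      associatedGradedMk K I ⟨Polynomial.monomial i r, h⟩ = a := by
  constructor
  · rintro ⟨x, ⟨r, hr⟩, rfl⟩
    have hr' : Polynomial.monomial i r = x.1 := hr
    have hmem : Polynomial.monomial i r ∈ reesAlgebra I := hr'.symm ▸ x.2
    exact ⟨r, hmem, congrArg (associatedGradedMk K I) (Subtype.ext hr')⟩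
  · rintro ⟨r, h, rfl⟩
    exact ⟨⟨Polynomial.monomial i r, h⟩, ⟨r, rfl⟩, rfl⟩

theorem mem_iSup_associatedGradedPiece (a : AssociatedGradedRing I) :
    a ∈ ⨆ i, associatedGradedPiece K I i := by
  obtain ⟨x, rfl⟩ := associatedGradedMk_surjective (K := K) a
  have hmem (i : ℕ) : Polynomial.monomial i (x.1.coeff i) ∈ reesAlgebra I :=
    reesAlgebra.monomial_mem.2 (x.2 i)
  have hx : x = ∑ i ∈ x.1.support, ⟨Polynomial.monomial i (x.1.coeff i), hmem i⟩ := by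
    apply Subtype.ext
    rw [AddSubmonoidClass.coe_finsetSum]
    exact x.1.as_sum_support
  rw [hx, map_sum]
  refine Submodule.sum_mem _ fun i _ => Submodule.mem_iSup_of_mem i ?_
  exact mem_associatedGradedPiece.2 ⟨_, hmem i, rfl⟩

end AssociatedGraded

section AperyAlgebra

variable {K : Type*} [Field K] {S : AddSubmonoid ℕ} {n : ℕ}

/-- The class of `t ^ s` in the component of degree `i`. -/
def aperyClass (K : Type*) [Field K] {S : AddSubmonoid ℕ} (n : ℕ) {i : ℕ} {s : S}
    (h : OrderGE S i s) : AperyAlgebra K S n :=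
  associatedGradedMk K (aperyMaximalIdeal K S n)
    ⟨Polynomial.monomial i (aperyMonomial K S n s),
      reesAlgebra.monomial_mem.2 (aperyMonomial_mem_pow h)⟩

theorem aperyClass_eq_zero {i : ℕ} {s : S} (h : OrderGE S i s)
    (hs : ¬ HasAperyOrder S n i s) : aperyClass K n h = 0 := by
  rw [aperyClass, associatedGradedMk_eq_zero]
  apply monomial_mem_map
  by_cases hap : (s : ℕ) ∈ aperySet S n
  · exact aperyMonomial_mem_pow (by_contra fun h' => hs ⟨hap, h, h'⟩)
  · have : aperyMonomial K S n s = 0 :=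
      Ideal.Quotient.eq_zero_iff_mem.2 (Ideal.subset_span ⟨s, hap, rfl⟩)
    rw [this]
    exact Ideal.zero_mem _

theorem linearIndependent_aperyClass {ι : Type*} {i : ι → ℕ} {s : ι → S}
    (h : ∀ k, HasAperyOrder S n (i k) (s k)) (hs : Function.Injective s) :
    LinearIndependent K fun k => aperyClass K n (h k).2.1 := by
  classical
  rw [linearIndependent_iff']
  intro T c hc k hk
  have hc' : associatedGradedMk K (aperyMaximalIdeal K S n) (∑ k ∈ T, c k •
      ⟨Polynomial.monomial (i k) (aperyMonomial K S n (s k)),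
        reesAlgebra.monomial_mem.2 (aperyMonomial_mem_pow (h k).2.1)⟩) = 0 := by
    rw [map_sum, ← hc]
    simp only [map_smul]
    rfl
  rw [associatedGradedMk_eq_zero] at hc'
  have h1 := coeff_mem_pow_succ_of_mem_map hc' (i k)
  have h2 : (∑ k ∈ T, c k • (⟨Polynomial.monomial (i k) (aperyMonomial K S n (s k)),
        reesAlgebra.monomial_mem.2 (aperyMonomial_mem_pow (h k).2.1)⟩ :
          reesAlgebra (aperyMaximalIdeal K S n))).1.coeff (i k) =
      Ideal.Quotient.mk (aperyIdeal K S n)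
        (∑ l ∈ T, if i l = i k then c l • semigroupMonomial K S (s l) else 0) := by
    rw [AddSubmonoidClass.coe_finsetSum, Polynomial.finsetSum_coeff, map_sum]
    refine Finset.sum_congr rfl fun l _ => ?_
    change (c l • Polynomial.monomial (i l) (aperyMonomial K S n (s l))).coeff (i k) = _
    rw [Polynomial.coeff_smul, Polynomial.coeff_monomial]
    split_ifs
    · rfl
    · rw [smul_zero, map_zero]
  rw [h2] at h1
  have h3 := coeff_eq_zero_of_mk_mem_pow h1 (h k).1 (h k).2.2
  rw [AddMonoidAlgebra.coeff_sum, Finsupp.finsetSum_apply, Finset.sum_eq_single k] at h3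
  · simpa [semigroupMonomial] using h3
  · intro l _ hlk
    split_ifs
    · simp [semigroupMonomial, hs.ne hlk]
    · simp
  · exact fun h => absurd hk h

theorem aperyClass_ne_zero {i : ℕ} {s : S} (h : HasAperyOrder S n i s) :
    aperyClass K n h.2.1 ≠ 0 :=
  (linearIndependent_aperyClass (K := K) (ι := Unit) (i := fun _ => i) (s := fun _ => s)
    (fun _ => h) fun _ _ _ => rfl).ne_zero ()

theorem aperyGrading_eq_span (i : ℕ) : aperyGrading K S n i =
    Submodule.span K {a | ∃ (s : S) (h : HasAperyOrder S n i s), a = aperyClass K n h.2.1} := by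
  apply le_antisymm
  · intro a ha
    obtain ⟨r, hr, rfl⟩ := mem_associatedGradedPiece.1 ha
    obtain ⟨f, hf, hsupp⟩ := exists_mk_eq_of_mem_pow (reesAlgebra.monomial_mem.1 hr)
    have hx : (⟨Polynomial.monomial i r, hr⟩ : reesAlgebra (aperyMaximalIdeal K S n)) =
        ∑ s ∈ f.coeff.support.attach, f.coeff s.1 •
          ⟨Polynomial.monomial i (aperyMonomial K S n s.1),
            reesAlgebra.monomial_mem.2 (aperyMonomial_mem_pow (hsupp s.1 s.2))⟩ := by
      apply Subtype.ext
      rw [AddSubmonoidClass.coe_finsetSum]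
      change Polynomial.monomial i r = ∑ s ∈ f.coeff.support.attach, f.coeff s.1 •
        Polynomial.monomial i (aperyMonomial K S n s.1)
      rw [Finset.sum_attach f.coeff.support fun s =>
        f.coeff s • Polynomial.monomial i (aperyMonomial K S n s), ← hf, mk_eq_sum, map_sum]
      simp only [Polynomial.smul_monomial]
    rw [hx, map_sum]
    refine Submodule.sum_mem _ fun s _ => ?_
    rw [map_smul]
    refine Submodule.smul_mem _ _ ?_
    change aperyClass K n (hsupp s.1 s.2) ∈ _
    by_cases hs : HasAperyOrder S n i s.1
    · exact Submodule.subset_span ⟨s.1, hs, rfl⟩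
    · rw [aperyClass_eq_zero _ hs]
      exact Submodule.zero_mem _
  · rw [Submodule.span_le]
    rintro _ ⟨s, h, rfl⟩
    exact mem_associatedGradedPiece.2 ⟨_, _, rfl⟩

theorem exists_generators (hcodim : Module.finrank K (aperyGrading K S n 1) = 3) :
    ∃ g : Fin 3 → S, Function.Injective g ∧ ∀ s : S, HasAperyOrder S n 1 s ↔ s ∈ Set.range g := by
  let ι := {s : S // HasAperyOrder S n 1 s}
  have hli : LinearIndependent K fun s : ι => aperyClass K n s.2.2.1 :=
    linearIndependent_aperyClass (fun s : ι => s.2) Subtype.val_injective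
  have hspan : aperyGrading K S n 1 =
      Submodule.span K (Set.range fun s : ι => aperyClass K n s.2.2.1) := by
    rw [aperyGrading_eq_span]
    congr 1
    ext a
    constructor
    · rintro ⟨s, h, rfl⟩
      exact ⟨⟨s, h⟩, rfl⟩
    · rintro ⟨s, rfl⟩
      exact ⟨s.1, s.2, rfl⟩
  have hcard : Nat.card ι = 3 := by
    rw [← hcodim, hspan]
    exact (Module.finrank_eq_nat_card_basis (Module.Basis.span hli)).symm
  have hfin : Finite ι := Nat.finite_of_card_ne_zero (by omega)
  let e : ι ≃ Fin 3 := Finite.equivFinOfCardEq hcard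
  refine ⟨fun j => (e.symm j).1, Subtype.val_injective.comp e.symm.injective, fun s => ?_⟩
  constructor
  · intro h
    exact ⟨e ⟨s, h⟩, by simp⟩
  · rintro ⟨j, rfl⟩
    exact (e.symm j).2

theorem orderGE_sum {g : Fin 3 → S} (hg : ∀ j, OrderGE S 1 (g j)) (b : Fin 3 → ℕ) :
    OrderGE S (∑ j, b j) (∑ j, b j • g j : S) := by
  have h1 (j : Fin 3) (k : ℕ) : OrderGE S k (k • g j : S) := by
    induction k with
    | zero => simp [OrderGE]
    | succ k ih => rw [succ_nsmul]; exact ih.add (hg j)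
  rw [Fin.sum_univ_three, Fin.sum_univ_three]
  exact ((h1 0 _).add (h1 1 _)).add (h1 2 _)

theorem prod_aperyClass_pow {g : Fin 3 → S} (hg : ∀ j, OrderGE S 1 (g j)) (b : Fin 3 → ℕ) :
    ∏ j, aperyClass K n (hg j) ^ b j = aperyClass K n (orderGE_sum hg b) := by
  simp only [aperyClass, ← map_pow, ← map_prod]
  congr 1
  apply Subtype.ext
  rw [SubmonoidClass.coe_finsetProd]
  simp only [Fin.prod_univ_three, Fin.sum_univ_three, SubmonoidClass.coe_pow,
    Polynomial.monomial_pow, Polynomial.monomial_mul_monomial, one_mul, aperyMonomial_add,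
    aperyMonomial_nsmul]

end AperyAlgebra

end

noncomputable section

section AperyPresentation

variable {K : Type*} [Field K] {S : AddSubmonoid ℕ} {n : ℕ}

theorem HasAperyOrder.exists_exponent {g : Fin 3 → S}
    (hg : ∀ s : S, HasAperyOrder S n 1 s ↔ s ∈ Set.range g) {i : ℕ} {s : S}
    (h : HasAperyOrder S n i s) : ∃ b : Fin 3 → ℕ, ∑ j, b j = i ∧ ∑ j, b j • g j = s := by
  induction i generalizing s with
  | zero => exact ⟨0, by simp, by simpa using (Subtype.ext h.eq_zero.symm : (0 : S) = s)⟩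
  | succ i ih =>
    obtain ⟨a, b, ha, hb, hs⟩ := h.exists_eq_add
    obtain ⟨c, hc, hcb⟩ := ih (s := ⟨b, hb.2.1.mem⟩) hb
    obtain ⟨j, hj⟩ := (hg ⟨a, ha.2.1.mem⟩).1 ha
    refine ⟨c + Pi.single j 1, ?_, ?_⟩
    · simp [Finset.sum_add_distrib, hc]
    · have h1 : ∑ k, (Pi.single j 1 : Fin 3 → ℕ) k • g k = g j := by
        rw [Finset.sum_eq_single j (fun k _ hk => by simp [hk]) (by simp)]
        simp
      simp only [Pi.add_apply, add_smul, Finset.sum_add_distrib, h1, hcb, hj]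
      apply Subtype.ext
      rw [hs, AddSubmonoid.coe_add]
      exact add_comm _ _

theorem exists_monomialPresentation (hS : IsNumericalSemigroup S) (hn0 : n ≠ 0)
    (hcodim : Module.finrank K (aperyGrading K S n 1) = 3)
    (hGor : IsGradedGorenstein (aperyGrading K S n)) :
    ∃ (y : Fin 3 → AperyAlgebra K S n) (g a : Fin 3 → ℕ), Function.Injective g ∧
      MonomialPresentation (aperyGrading K S n) y g a := by
  classical
  obtain ⟨g, hginj, hg⟩ := exists_generators hcodim
  have hg1 (j : Fin 3) : OrderGE S 1 (g j) := ((hg (g j)).2 ⟨j, rfl⟩).2.1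
  obtain ⟨y, hy⟩ : ∃ y : Fin 3 → AperyAlgebra K S n, y = fun j => aperyClass K n (hg1 j) :=
    ⟨_, rfl⟩
  have hprod (b : Fin 3 → ℕ) : ∏ j, y j ^ b j = aperyClass K n (orderGE_sum hg1 b) := by
    rw [hy]; exact prod_aperyClass_pow hg1 b
  have hne (b : Fin 3 → ℕ) : ∏ j, y j ^ b j ≠ 0 ↔
      HasAperyOrder S n (∑ j, b j) (∑ j, b j • g j : S) := by
    rw [hprod]
    exact ⟨fun h => by_contra fun h' => h (aperyClass_eq_zero _ h'), fun h => aperyClass_ne_zero h⟩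
  have hcongr {i i' : ℕ} {s s' : S} (h : OrderGE S i s) (h' : OrderGE S i' s') (hi : i = i')
      (hs : s = s') : aperyClass K n h = aperyClass K n h' := by
    subst hi hs; rfl
  have hw (b : Fin 3 → ℕ) : ((∑ j, b j • g j : S) : ℕ) = ∑ j, b j * (g j : ℕ) := by
    rw [AddSubmonoidClass.coe_finsetSum]
    simp
  have hweq {b b' : Fin 3 → ℕ} (h : ∑ j, b j * (g j : ℕ) = ∑ j, b' j * (g j : ℕ)) :
      ∑ j, b j • g j = ∑ j, b' j • g j := Subtype.ext (by rw [hw, hw, h])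
  have hgrading (k : ℕ) : aperyGrading K S n k =
      Submodule.span K ((fun b : Fin 3 → ℕ => ∏ i, y i ^ b i) '' {b | ∑ i, b i = k}) := by
    rw [aperyGrading_eq_span]
    apply le_antisymm <;> rw [Submodule.span_le]
    · rintro _ ⟨s, h, rfl⟩
      obtain ⟨b, hb, hbs⟩ := h.exists_exponent hg
      refine Submodule.subset_span ⟨b, hb, ?_⟩
      simp only [hprod]
      exact hcongr _ _ hb hbs
    · rintro _ ⟨b, hb, rfl⟩
      by_cases hz : ∏ j, y j ^ b j = 0
      · simp only [hz]; exact Submodule.zero_mem _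
      · have h := (hne b).1 hz
        have hb' : ∑ j, b j = k := hb
        refine Submodule.subset_span ⟨_, hb' ▸ h, ?_⟩
        simp only [hprod]
        exact hcongr _ _ hb' rfl
  have htop : Submodule.span K (Set.range fun b : Fin 3 → ℕ => ∏ i, y i ^ b i) = ⊤ := by
    rw [eq_top_iff]
    intro a _
    refine (iSup_le fun i => ?_ : ⨆ i, aperyGrading K S n i ≤ _) (mem_iSup_associatedGradedPiece a)
    rw [hgrading]
    exact Submodule.span_mono (Set.image_subset_range _ _)
  have hlin (N : Finset (Fin 3 → ℕ)) (hN : ∀ b ∈ N, ∏ i, y i ^ b i ≠ 0)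
      (hNN : ∀ b ∈ N, ∀ b' ∈ N, ∑ i, b i = ∑ i, b' i →
        ∑ i, b i * (g i : ℕ) = ∑ i, b' i * (g i : ℕ) → b = b') :
      LinearIndependent K fun b : N => ∏ i, y i ^ b.1 i := by
    have := linearIndependent_aperyClass (K := K) (fun b : N => (hne b.1).1 (hN b.1 b.2)) (by
      intro b b' h
      have h' : (∑ j, b.1 j • g j : S) = ∑ j, b'.1 j • g j := h
      refine Subtype.ext (hNN b.1 b.2 b'.1 b'.2 ?_ ?_)
      · have h1 := (hne b.1).1 (hN b.1 b.2)
        rw [h'] at h1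
        exact h1.unique ((hne b'.1).1 (hN b'.1 b'.2))
      · rw [← hw, ← hw, h'])
    convert this using 1
    funext b
    exact hprod b.1
  obtain ⟨B, hB⟩ := aperySet_bounded hS n
  have hmax (m : ℕ) : ∀ b : Fin 3 → ℕ, B - ∑ j, b j = m → ∏ j, y j ^ b j ≠ 0 →
      ∃ a : Fin 3 → ℕ, b ≤ a ∧ ∏ j, y j ^ a j ≠ 0 ∧ ∀ i, y i * ∏ j, y j ^ a j = 0 := by
    induction m using Nat.strong_induction_on with
    | _ m ih =>
      intro b hm hb
      by_cases hall : ∀ i, y i * ∏ j, y j ^ b j = 0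
      · exact ⟨b, le_refl b, hb, hall⟩
      · push Not at hall
        obtain ⟨i, hi⟩ := hall
        rw [← prod_pow_add_single] at hi
        have h1 := (hne _).1 hi
        have h2 := h1.2.1.le
        have h3 := hB _ h1.1
        have h4 : ∑ j, (b + Pi.single i 1 : Fin 3 → ℕ) j = ∑ j, b j + 1 := by
          simp [Finset.sum_add_distrib]
        obtain ⟨a, ha, ha'⟩ := ih _ (by omega) (b + Pi.single i 1) rfl hi
        exact ⟨a, le_trans (le_add_of_nonneg_right zero_le) ha, ha'⟩
  have hsocle (a : Fin 3 → ℕ) (ha : ∀ i, y i * ∏ j, y j ^ a j = 0) :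
      ∏ j, y j ^ a j ∈ gradedSocle (aperyGrading K S n) := by
    intro k hk x hx
    rw [hgrading] at hx
    induction hx using Submodule.span_induction with
    | mem x hx =>
      obtain ⟨b, hb, rfl⟩ := hx
      have hb' : ∑ j, b j = k := hb
      obtain ⟨i, -, hi⟩ := Finset.exists_ne_zero_of_sum_ne_zero (by rw [hb']; exact hk.ne')
      simp only
      rw [← Finset.mul_prod_erase _ _ (Finset.mem_univ i), ← Nat.succ_pred_eq_of_ne_zero hi,
        pow_succ, mul_assoc, mul_assoc, mul_left_comm (y i), ha i, mul_zero, mul_zero]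
    | zero => rw [zero_mul]
    | add u v _ _ hu hv => rw [add_mul, hu, hv, add_zero]
    | smul c u _ hu => rw [smul_mul_assoc, hu, smul_zero]
  have htopne : ∏ j, y j ^ (0 : Fin 3 → ℕ) j ≠ 0 := by
    rw [hne]
    simpa using HasAperyOrder.zero (S := S) hn0
  obtain ⟨a, -, ha, hatop⟩ := hmax _ 0 rfl htopne
  obtain ⟨v, -, hv⟩ := finrank_eq_one_iff'.1 hGor
  have hsame (a' : Fin 3 → ℕ) (ha' : ∏ j, y j ^ a' j ≠ 0)
      (hatop' : ∀ i, y i * ∏ j, y j ^ a' j = 0) :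
      ∑ j, a' j • g j = ∑ j, a j • g j := by
    by_contra hneq
    obtain ⟨c, hc⟩ := hv ⟨_, hsocle a hatop⟩
    obtain ⟨c', hc'⟩ := hv ⟨_, hsocle a' hatop'⟩
    replace hc : c • v.1 = ∏ j, y j ^ a j := congrArg Subtype.val hc
    replace hc' : c' • v.1 = ∏ j, y j ^ a' j := congrArg Subtype.val hc'
    have haa : a ≠ a' := fun h => hneq (by rw [h])
    have hli := hlin {a, a'} (by simp [ha, ha']) (by
      intro b hb b' hb' _ h2
      have h3 := hweq h2
      simp only [Finset.mem_insert, Finset.mem_singleton] at hb hb'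
      rcases hb with rfl | rfl <;> rcases hb' with rfl | rfl
      · rfl
      · exact absurd h3.symm hneq
      · exact absurd h3 hneq
      · rfl)
    have h2 := hli.comp ![⟨a, by simp⟩, ⟨a', by simp⟩] (by
      intro i j hij
      fin_cases i <;> fin_cases j <;> simp [haa, haa.symm] at hij ⊢)
    have h3 : LinearIndependent K ![∏ j, y j ^ a j, ∏ j, y j ^ a' j] := by
      convert h2 using 1
      funext i
      fin_cases i <;> rfl
    have h4 := (LinearIndependent.pair_iff.1 h3 c' (-c) (by
      rw [← hc, ← hc', smul_smul, smul_smul, ← add_smul]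
      rw [show c' * c + -c * c' = 0 by ring, zero_smul])).1
    rw [h4, zero_smul] at hc'
    exact ha' hc'.symm
  refine ⟨y, fun j => g j, a, Subtype.val_injective.comp hginj, hgrading, htop, fun b => ?_,
    fun b b' hb hb' h => ?_, hlin⟩
  · constructor
    · intro hb
      obtain ⟨a', hba, ha', hatop'⟩ := hmax _ b rfl hb
      have h1 := hsame a' ha' hatop'
      refine ⟨a', hba, ?_, by rw [← hw, ← hw, h1]⟩
      have h2 := (hne a').1 ha'
      rw [h1] at h2
      exact h2.unique ((hne a).1 ha)
    · rintro ⟨a', hba, h1, h2⟩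
      have ha' : ∏ j, y j ^ a' j ≠ 0 := by
        rw [hne, h1, hweq h2]
        exact (hne a).1 ha
      intro hz
      apply ha'
      have h3 : ∏ j, y j ^ a' j = (∏ j, y j ^ b j) * ∏ j, y j ^ (a' j - b j) := by
        rw [← Finset.prod_mul_distrib]
        refine Finset.prod_congr rfl fun j _ => ?_
        rw [← pow_add, Nat.add_sub_cancel' (hba j)]
      rw [h3, hz, zero_mul]
  · rw [hprod, hprod]
    have h1 := (hne b).1 hb
    rw [hweq h] at h1
    exact hcongr _ _ (h1.unique ((hne b').1 hb')) (hweq h)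

end AperyPresentation

end

theorem corollary3p3 (K : Type*) [Field K] [CharZero K]
    (S : AddSubmonoid ℕ) (hS : IsNumericalSemigroup S)
    (n : ℕ) (hn : n ∈ S) (hn0 : n ≠ 0)
    (hcodim : Module.finrank K (aperyGrading K S n 1) = 3)
    (hGor : IsGradedGorenstein (aperyGrading K S n)) :
    HasSLP (aperyGrading K S n) ∧
      ∃ d α : Fin 3 → ℕ, (∀ j, α j ≤ d j) ∧ d 0 = α 1 + α 2 ∧
        ∃ e : AperyAlgebra K S n ≃ₐ[K] (MvPolynomial (Fin 3) K ⧸ binomialIdeal K (-1) d α),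
          ∀ i, (aperyGrading K S n i).map e.toLinearMap =
            quotientGrading (binomialIdeal K (-1) d α) i := by
  obtain ⟨y, g, a, hg, h⟩ := exists_monomialPresentation hS hn0 hcodim hGor
  exact h.hasSLP_and_exists_algEquiv hg
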